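/- For $n \ge 1$ write $[n] = \{1,\dots,n\}$, and let $\|\cdot\|$ be the Euclidean norm. For a positive integer $\ell$, a set $S \subset \mathbb{R}^d$ is called $\ell$-hole-free if, for any $\ell$ distinct points $s_1,\dots,s_\ell \in S$, there is a point $s \in S$ in the interior (in $\mathbb{R}^d$) of the convex hull of $\{s_1,\dots,s_\ell\}$. There are positive integers $C'_d$ ($d \ge 2$), with $C'_d$ depending only on $d$, such that $C'_d = d^{O(d^3)}$ (that is, for some absolute constant $K$ one has $C'_d \le d^{K d^3}$ for all $d \ge 2$), $C'_2 = 7$, and the following holds. For all integers $n \ge 1$ and $d \ge 2$ and every real $\varepsilon > 0$, there is a family of pairwise distinct points $P_x \in \mathbb{R}^d$, $x \in [n]^d$, such that $\|P_x - x\| < \varepsilon$ for all $x \in [n]^d$ and the set $\{P_x : x \in [n]^d\}$ is $C'_d$-hole-free. -/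

import Mathlib

/-- The lattice cube `[n]^d`, with `[n] = {1, …, n}`, as a set of points of Euclidean space `ℝ^d`. -/
def latticeCube (d n : ℕ) : Set (EuclideanSpace ℝ (Fin d)) :=
  {x | ∀ i, ∃ m ∈ Finset.Icc 1 n, x i = (m : ℝ)}

/-- `S ⊆ ℝ^d` is `ℓ`-hole-free if, for any `ℓ` (distinct) points of `S`, some point of `S` lies in
the interior (taken in `ℝ^d`) of the convex hull of these `ℓ` points. -/
def IsHoleFree {d : ℕ} (ℓ : ℕ) (S : Set (EuclideanSpace ℝ (Fin d))) : Prop :=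
  ∀ A : Finset (EuclideanSpace ℝ (Fin d)), (A : Set (EuclideanSpace ℝ (Fin d))) ⊆ S →
    A.card = ℓ → ∃ s ∈ S, s ∈ interior (convexHull ℝ (A : Set (EuclideanSpace ℝ (Fin d))))

/-- `f` restricts to an `ε`-perturbation from `A` to `B`: a bijection from `A` onto `B` that moves
every point of `A` by less than `ε` in the Euclidean norm. -/
def IsPerturbation {d : ℕ} (ε : ℝ) (f : EuclideanSpace ℝ (Fin d) → EuclideanSpace ℝ (Fin d))
    (A B : Set (EuclideanSpace ℝ (Fin d))) : Prop :=
  Set.BijOn f A B ∧ ∀ x ∈ A, ‖x - f x‖ < ε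

open Filter Topology

/-! The perturbation is of Horton type. Points are pushed along a vector by `towerHeight`, whose
`k`-th term depends on residues modulo `p ^ (k + 1)` and has weight `r ^ (k + 1)`. For small `r` the
first digit at which points differ decides which is higher. Suppose `y` is in the relative interior
of the hull of `C' ⊆ C`, and its height lies strictly between two heights obtained by interpolating
over `C` at `y`. Then the pushed `y` is in the relative interior of the pushed hull, and the push
direction is gained (`IsCorePoint.perturb`). The digit condition `DigitAbove` guarantees such
interpolations.

For `d ≠ 2`, push along the `d` coordinate vectors in turn, using distinct primes. Given many
points, pigeonholing residues twice per prime (`exists_split`) gives nested subsets down to some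
`B`, and for each prime a residue class such that any `y` in it satisfies the digit condition above
and below. If the affine span drops along the chain, the argument restarts inside `B`; this happens
at most `d` times (`exists_chain_vectorSpan_eq`). It remains to find a lattice point in the relative
interior of the hull of `B` with the prescribed residues. The Chinese remainder theorem does this,
because `B` is also congruent modulo some `M > d` prime to all the primes used
(`exists_core_latticePoint`). After `d` pushes all directions are gained, so `y` has become an
interior point. The constant is the cost of these pigeonholes, and a bound on the first `d` primes
makes it `d ^ O(d ^ 3)`.

For `d = 2`, a single push in base `2` suffices, along a vector transversal to all lines through two
points of the box. Seven lattice points have an interior lattice point, which survives small pushes,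
or four of them are collinear (`exists_interior_or_four_on_line`). Four collinear points give a `y`
between two of them with an interpolation on one prescribed side; a point off the line supplies the
other side. If all seven are collinear, they supply both sides themselves. -/

/-- `z` stays in `G` when it is moved a little in any direction of the subspace `F`. -/
def IsCorePoint {E : Type*} [AddCommGroup E] [Module ℝ E] (F : Submodule ℝ E) (G : Set E) (z : E) :
    Prop :=
  ∀ v ∈ F, ∃ τ : ℝ, 0 < τ ∧ z + τ • v ∈ G

/-! ### Relative interior points and their behaviour under a push in one direction. -/

section CorePoint

variable {E : Type*} [AddCommGroup E] [Module ℝ E]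

theorem IsCorePoint.mem {F : Submodule ℝ E} {G : Set E} {z : E} (h : IsCorePoint F G z) :
    z ∈ G := by
  obtain ⟨τ, -, h⟩ := h 0 F.zero_mem
  simpa using h

theorem IsCorePoint.mono {F F' : Submodule ℝ E} {G G' : Set E} {z : E} (h : IsCorePoint F G z)
    (hF : F' ≤ F) (hG : G ⊆ G') : IsCorePoint F' G' z := fun v hv ↦ by
  obtain ⟨τ, hτ, h⟩ := h v (hF hv)
  exact ⟨τ, hτ, hG h⟩

theorem isCorePoint_of_mem_interior {E : Type*} [NormedAddCommGroup E] [NormedSpace ℝ E]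
    {F : Submodule ℝ E} {G : Set E} {z : E} (h : z ∈ interior G) : IsCorePoint F G z := by
  intro v _
  have hc : Tendsto (fun τ : ℝ ↦ z + τ • v) (𝓝[>] 0) (𝓝 z) := by
    have : Continuous (fun τ : ℝ ↦ z + τ • v) := by fun_prop
    simpa using (this.tendsto 0).mono_left nhdsWithin_le_nhds
  have h1 := hc.eventually (mem_interior_iff_mem_nhds.1 h)
  obtain ⟨τ, h2, h3⟩ := (h1.and self_mem_nhdsWithin).exists
  exact ⟨τ, h3, h2⟩

/-- The available moves span the space, so `G` has an interior point `g`. The segment from `g` can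
be prolonged beyond `z` inside `G`, so `z` lies strictly between `g` and a point of `G`. -/
theorem IsCorePoint.mem_interior {E : Type*} [NormedAddCommGroup E] [NormedSpace ℝ E]
    [FiniteDimensional ℝ E] {G : Set E} (hG : Convex ℝ G) {z : E} (h : IsCorePoint ⊤ G z) :
    z ∈ interior G := by
  have hspan : affineSpan ℝ G = ⊤ := by
    have hz : z ∈ affineSpan ℝ G := subset_affineSpan ℝ G h.mem
    rw [AffineSubspace.affineSpan_eq_top_iff_vectorSpan_eq_top_of_nonempty ℝ E E ⟨z, h.mem⟩,
      eq_top_iff]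
    intro v _
    obtain ⟨τ, hτ, hv⟩ := h v trivial
    have h1 := vsub_mem_vectorSpan ℝ hv h.mem
    rw [vsub_eq_sub, add_sub_cancel_left] at h1
    have := (vectorSpan ℝ G).smul_mem τ⁻¹ h1
    rwa [smul_smul, inv_mul_cancel₀ hτ.ne', one_smul] at this
  obtain ⟨g, hg⟩ := hG.interior_nonempty_iff_affineSpan_eq_top.2 hspan
  obtain ⟨τ, hτ, hv⟩ := h (z - g) trivial
  have := hG.combo_interior_self_mem_interior hg hv (a := τ / (1 + τ)) (b := 1 / (1 + τ))
    (by positivity) (by positivity) (by field_simp; ring)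
  convert this using 1
  have h1 : (1 + τ) ≠ 0 := by positivity
  have h2 : (1 / (1 + τ)) • (z + τ • (z - g)) + (τ / (1 + τ)) • g
      = ((1 / (1 + τ)) * (1 + τ)) • z := by
    module
  rw [add_comm, h2, one_div, inv_mul_cancel₀ h1, one_smul]

/-- Moves along `F` need only be possible up to an uncontrolled error `μ • e`: mixing in a small
proportion `s` of the erroneous point leaves an error that the slack on the `e`-segment absorbs. -/
theorem IsCorePoint.sup_span {F : Submodule ℝ E} {G : Set E} (hG : Convex ℝ G) {z e : E}
    {a b c : ℝ} (hab : a < b) (hbc : b < c) (ha : z + a • e ∈ G) (hc : z + c • e ∈ G)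
    (hF : ∀ v ∈ F, ∃ τ : ℝ, 0 < τ ∧ ∃ μ : ℝ, z + τ • v + μ • e ∈ G) :
    IsCorePoint (F ⊔ Submodule.span ℝ {e}) G (z + b • e) := by
  intro w hw
  obtain ⟨v, hv, u, hu, rfl⟩ := Submodule.mem_sup.1 hw
  obtain ⟨t, rfl⟩ := Submodule.mem_span_singleton.1 hu
  obtain ⟨τ, hτ, μ, hμ⟩ := hF v hv
  -- intermediate points `z + x • e` with `a ≤ x ≤ c` lie in `G`
  have hmid : ∀ x, a < x → x < c → z + x • e ∈ G := by
    intro x hx hx'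
    have hca : 0 < c - a := by linarith
    have := hG ha hc (a := (c - x) / (c - a)) (b := (x - a) / (c - a))
      (div_nonneg (by linarith) hca.le) (div_nonneg (by linarith) hca.le)
      (by field_simp; ring)
    convert this using 1
    have e1 : x = (c - x) / (c - a) * a + (x - a) / (c - a) * c := by field_simp; ring
    have e2 : (1 : ℝ) = (c - x) / (c - a) + (x - a) / (c - a) := by field_simp; ring
    calc z + x • e = (1 : ℝ) • z + x • e := by rw [one_smul]
      _ = ((c - x) / (c - a) + (x - a) / (c - a)) • z
          + ((c - x) / (c - a) * a + (x - a) / (c - a) * c) • e := by rw [← e1, ← e2]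
      _ = _ := by module
  -- This is the position on the `e`-segment that, mixed with weight `1 - s`, cancels the error and
  -- produces the wanted `e`-component; it tends to `b`.
  have hlim : Tendsto (fun s : ℝ ↦ (b + s * τ * t - s * μ) / (1 - s)) (𝓝[>] 0) (𝓝 b) := by
    have : ContinuousAt (fun s : ℝ ↦ (b + s * τ * t - s * μ) / (1 - s)) 0 :=
      ContinuousAt.div (by fun_prop) (by fun_prop) (by norm_num)
    simpa using this.tendsto.mono_left nhdsWithin_le_nhds
  have hs1 : ∀ᶠ s : ℝ in 𝓝[>] 0, s < 1 :=
    nhdsWithin_le_nhds (gt_mem_nhds (by norm_num))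
  obtain ⟨s, h1, h2, h3, h4⟩ := ((hlim.eventually (lt_mem_nhds hab)).and
    ((hlim.eventually (gt_mem_nhds hbc)).and (hs1.and self_mem_nhdsWithin))).exists
  have h4 : 0 < s := h4
  have h5 : (1 - s) ≠ 0 := by linarith
  refine ⟨s * τ, by positivity, ?_⟩
  have := hG (hmid _ h1 h2) hμ (a := 1 - s) (b := s) (by linarith) h4.le (by ring)
  convert this using 1
  have e1 : b + s * τ * t = (1 - s) * ((b + s * τ * t - s * μ) / (1 - s)) + s * μ := by
    field_simp; ring
  calc z + b • e + (s * τ) • (v + t • e) = z + (s * τ) • v + (b + s * τ * t) • e := by module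
    _ = z + (s * τ) • v + ((1 - s) * ((b + s * τ * t - s * μ) / (1 - s)) + s * μ) • e := by
      rw [← e1]
    _ = _ := by module

theorem exists_weights_of_mem_convexHull_image {ι : Type*} {C : Finset ι} {Q : ι → E} {z : E}
    (h : z ∈ convexHull ℝ (Q '' C)) :
    ∃ w : ι → ℝ, (∀ i, 0 ≤ w i) ∧ (∀ i ∉ C, w i = 0) ∧ ∑ i ∈ C, w i = 1 ∧
      ∑ i ∈ C, w i • Q i = z := by
  classical
  have hconv : Convex ℝ {z : E | ∃ w : ι → ℝ, (∀ i, 0 ≤ w i) ∧ (∀ i ∉ C, w i = 0) ∧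
      ∑ i ∈ C, w i = 1 ∧ ∑ i ∈ C, w i • Q i = z} := by
    rintro _ ⟨w, h1, h2, h3, rfl⟩ _ ⟨w', h1', h2', h3', rfl⟩ a b ha hb hab
    refine ⟨fun i ↦ a * w i + b * w' i, fun i ↦ ?_, fun i hi ↦ ?_, ?_, ?_⟩
    · have := h1 i; have := h1' i; positivity
    · simp [h2 i hi, h2' i hi]
    · rw [Finset.sum_add_distrib, ← Finset.mul_sum, ← Finset.mul_sum, h3, h3']; linarith
    · simp only [add_smul, mul_smul, Finset.sum_add_distrib, Finset.smul_sum]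
  refine convexHull_min ?_ hconv h
  rintro _ ⟨i, hi, rfl⟩
  refine ⟨fun j ↦ if j = i then 1 else 0, fun j ↦ ?_, fun j hj ↦ ?_, ?_, ?_⟩
  · dsimp only; split_ifs <;> norm_num
  · dsimp only; rw [if_neg]; rintro rfl; exact hj hi
  · simpa using hi
  · have : i ∈ C := hi
    simp [ite_smul, this]

theorem sum_smul_mem_convexHull_image {ι : Type*} {C : Finset ι} {Q : ι → E} {w : ι → ℝ}
    (h : ∀ i ∈ C, 0 ≤ w i) (h1 : ∑ i ∈ C, w i = 1) :
    ∑ i ∈ C, w i • Q i ∈ convexHull ℝ (Q '' C) :=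
  (convex_convexHull ℝ _).sum_mem h h1 fun i hi ↦
    subset_convexHull ℝ _ ⟨i, hi, rfl⟩

theorem sum_add_smul_mem_convexHull_image {ι : Type*} {C : Finset ι} {Q : ι → E} {w : ι → ℝ}
    {h : ι → ℝ} {e : E} (hw : ∀ i ∈ C, 0 ≤ w i) (h1 : ∑ i ∈ C, w i = 1) :
    ∑ i ∈ C, w i • Q i + (∑ i ∈ C, w i * h i) • e ∈
      convexHull ℝ ((fun i ↦ Q i + h i • e) '' C) := by
  have := sum_smul_mem_convexHull_image (Q := fun i ↦ Q i + h i • e) hw h1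
  convert this using 1
  simp only [smul_add, Finset.sum_add_distrib, smul_smul, Finset.sum_smul]

/-- Moving the points `Q i` by `h i • e` keeps a core point a core point, and adds the direction `e`,
when the value of `h` at the point lies strictly between two of its interpolations. -/
theorem IsCorePoint.perturb {ι : Type*} {F : Submodule ℝ E} {C' C : Finset ι} (hC : C' ⊆ C)
    {Q : ι → E} {y : ι} {h : ι → ℝ} {e : E}
    (hcore : IsCorePoint F (convexHull ℝ (Q '' C')) (Q y)) {a c : ℝ} (ha : a < h y) (hc : h y < c)
    (ha' : Q y + a • e ∈ convexHull ℝ ((fun i ↦ Q i + h i • e) '' C))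
    (hc' : Q y + c • e ∈ convexHull ℝ ((fun i ↦ Q i + h i • e) '' C)) :
    IsCorePoint (F ⊔ Submodule.span ℝ {e}) (convexHull ℝ ((fun i ↦ Q i + h i • e) '' C))
      (Q y + h y • e) := by
  refine IsCorePoint.sup_span (convex_convexHull ℝ _) ha hc ha' hc' fun v hv ↦ ?_
  obtain ⟨τ, hτ, hv⟩ := hcore v hv
  obtain ⟨w, h1, -, h3, h4⟩ := exists_weights_of_mem_convexHull_image hv
  refine ⟨τ, hτ, ∑ i ∈ C', w i * h i, ?_⟩
  rw [← h4]
  exact convexHull_mono (Set.image_mono (by exact_mod_cast hC))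
    (sum_add_smul_mem_convexHull_image (fun i _ ↦ h1 i) h3)

end CorePoint

/-! ### Digits of lattice points and the height function built from them. -/

section Tower

variable {d : ℕ}

/-- Coordinatewise congruence of integer points. -/
def LatticeCong (m : ℕ) (x y : Fin d → ℤ) : Prop := ∀ i, (m : ℤ) ∣ x i - y i

theorem LatticeCong.refl (m : ℕ) (x : Fin d → ℤ) : LatticeCong m x x := fun i ↦ by simp

theorem LatticeCong.symm {m : ℕ} {x y : Fin d → ℤ} (h : LatticeCong m x y) : LatticeCong m y x :=
  fun i ↦ by rw [← neg_sub]; exact (h i).neg_right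

theorem LatticeCong.trans {m : ℕ} {x y z : Fin d → ℤ} (h : LatticeCong m x y)
    (h' : LatticeCong m y z) : LatticeCong m x z :=
  fun i ↦ by simpa using (h i).add (h' i)

theorem LatticeCong.of_dvd {m m' : ℕ} (hm : m' ∣ m) {x y : Fin d → ℤ} (h : LatticeCong m x y) :
    LatticeCong m' x y :=
  fun i ↦ (Int.natCast_dvd_natCast.2 hm).trans (h i)

/-- A real number that encodes the residues modulo `m` of the coordinates of an integer point. -/
noncomputable def residueCode (m : ℕ) (x : Fin d → ℤ) : ℝ :=
  ((exists_injective_nat (Fin d → ℤ)).choose (fun i ↦ x i % m) : ℝ)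

theorem residueCode_eq_iff {m : ℕ} {x y : Fin d → ℤ} :
    residueCode m x = residueCode m y ↔ LatticeCong m x y := by
  unfold residueCode LatticeCong
  rw [Nat.cast_inj, (exists_injective_nat (Fin d → ℤ)).choose_spec.eq_iff, funext_iff]
  refine forall_congr' fun i ↦ ?_
  rw [eq_comm]
  exact Int.modEq_iff_dvd

/-- The Horton-type height function: the `k`-th digit of `x` in base `p` contributes at the scale
`r ^ (k + 1)`. -/
noncomputable def towerHeight (p K : ℕ) (r : ℝ) (x : Fin d → ℤ) : ℝ :=
  ∑ k ∈ Finset.range K, r ^ (k + 1) * residueCode (p ^ (k + 1)) x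

theorem tendsto_towerHeight (p K : ℕ) (x : Fin d → ℤ) :
    Tendsto (fun r ↦ towerHeight p K r x) (𝓝[>] 0) (𝓝 0) := by
  have : Continuous (fun r ↦ towerHeight p K r x) := by unfold towerHeight; fun_prop
  have h := (this.tendsto 0).mono_left (nhdsWithin_le_nhds (s := Set.Ioi 0))
  simpa [towerHeight] using h

theorem eventually_pos_of_leading_coeff_pos {K k : ℕ} (hk : k < K) {γ : ℕ → ℝ}
    (h0 : ∀ j < k, γ j = 0) (hpos : 0 < γ k) :
    ∀ᶠ r : ℝ in 𝓝[>] 0, 0 < ∑ j ∈ Finset.range K, r ^ (j + 1) * γ j := by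
  have hc : Continuous (fun r : ℝ ↦ ∑ i ∈ Finset.range (K - k), r ^ i * γ (k + i)) := by fun_prop
  have hlim := (hc.tendsto 0).mono_left (nhdsWithin_le_nhds (s := Set.Ioi 0))
  have hval : ∑ i ∈ Finset.range (K - k), (0 : ℝ) ^ i * γ (k + i) = γ k := by
    rw [Finset.sum_eq_single 0]
    · simp
    · intro b _ hb; simp [hb]
    · intro h; simp at h; omega
  rw [hval] at hlim
  filter_upwards [hlim.eventually (lt_mem_nhds hpos), self_mem_nhdsWithin] with r hr hr0
  have hr0 : 0 < r := hr0
  have : ∑ j ∈ Finset.range K, r ^ (j + 1) * γ j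
      = r ^ (k + 1) * ∑ i ∈ Finset.range (K - k), r ^ i * γ (k + i) := by
    rw [show K = k + (K - k) by omega, Finset.sum_range_add, Finset.sum_eq_zero, zero_add,
      Finset.mul_sum, Nat.add_sub_cancel_left]
    · refine Finset.sum_congr rfl fun i _ ↦ ?_
      ring
    · intro j hj
      rw [h0 j (Finset.mem_range.1 hj), mul_zero]
  rw [this]
  positivity

/-- Up to the sign `s`, at the first digit where they differ, no point of `C'` is lower than `y`,
and some point of `C` is strictly higher. -/
def DigitAbove (p K : ℕ) (s : ℝ) (C C' : Finset (Fin d → ℤ)) (y : Fin d → ℤ) : Prop :=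
  ∃ k < K, (∀ c ∈ C', LatticeCong (p ^ k) c y ∧
      s * residueCode (p ^ (k + 1)) y ≤ s * residueCode (p ^ (k + 1)) c) ∧
    ∃ a ∈ C, LatticeCong (p ^ k) a y ∧
      s * residueCode (p ^ (k + 1)) y < s * residueCode (p ^ (k + 1)) a

/-- Backing away from `Q a` stays in the hull of `C'`, and mixing with `Q a` returns to `Q y`. The
resulting weights live on `C' ∪ {a}` and are positive at `a`, so in the height difference the terms
before digit `k` vanish and the `k`-th coefficient is positive. -/
theorem DigitAbove.exists_weights {E : Type*} [AddCommGroup E] [Module ℝ E] {p K : ℕ} {s : ℝ}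
    {C C' : Finset (Fin d → ℤ)} {y : Fin d → ℤ} (h : DigitAbove p K s C C' y) (hC : C' ⊆ C)
    {F : Submodule ℝ E} {Q : (Fin d → ℤ) → E}
    (hcore : IsCorePoint F (convexHull ℝ (Q '' C')) (Q y)) (hF : ∀ a ∈ C, Q a - Q y ∈ F) :
    ∃ w : (Fin d → ℤ) → ℝ, (∀ c ∈ C, 0 ≤ w c) ∧ ∑ c ∈ C, w c = 1 ∧ ∑ c ∈ C, w c • Q c = Q y ∧
      ∀ᶠ r : ℝ in 𝓝[>] 0, s * towerHeight p K r y < s * ∑ c ∈ C, w c * towerHeight p K r c := by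
  classical
  obtain ⟨k, hk, hC', a, ha, hay, hlt⟩ := h
  obtain ⟨τ, hτ, hmem⟩ := hcore (-(Q a - Q y)) (F.neg_mem (hF a ha))
  obtain ⟨w, h1, h2, h3, h4⟩ := exists_weights_of_mem_convexHull_image hmem
  have h5 : ∑ c ∈ C, w c = 1 := by
    rw [← h3]; exact (Finset.sum_subset hC fun c _ hc ↦ h2 c hc).symm
  have h6 : ∑ c ∈ C, w c • Q c = Q y + τ • -(Q a - Q y) := by
    rw [← h4]; exact (Finset.sum_subset hC fun c _ hc ↦ by simp [h2 c hc]).symm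
  have hτ1 : (1 + τ) ≠ 0 := by positivity
  set w' : (Fin d → ℤ) → ℝ := fun c ↦ (1 + τ)⁻¹ * (w c + if c = a then τ else 0) with hw'
  have hw'0 : ∀ c, 0 ≤ w' c := fun c ↦ by
    have := h1 c
    simp only [hw']
    split_ifs <;> positivity
  have hsum : ∑ c ∈ C, w' c = 1 := by
    simp only [hw', ← Finset.mul_sum, Finset.sum_add_distrib, h5]
    rw [Finset.sum_ite_eq' C a, if_pos ha, inv_mul_cancel₀ hτ1]
  refine ⟨w', fun c _ ↦ hw'0 c, hsum, ?_, ?_⟩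
  · simp only [hw', mul_smul, ← Finset.smul_sum, add_smul, Finset.sum_add_distrib, h6, ite_smul,
      zero_smul]
    rw [Finset.sum_ite_eq' C a, if_pos ha]
    have : Q y + τ • -(Q a - Q y) + τ • Q a = (1 + τ) • Q y := by module
    rw [this, smul_smul, inv_mul_cancel₀ hτ1, one_smul]
  · have hsupp : ∀ c ∈ C, w' c ≠ 0 → LatticeCong (p ^ k) c y ∧
        s * residueCode (p ^ (k + 1)) y ≤ s * residueCode (p ^ (k + 1)) c := by
      intro c _ hwc
      by_cases hca : c = a
      · subst hca; exact ⟨hay, hlt.le⟩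
      · by_cases hcC : c ∈ C'
        · exact hC' c hcC
        · exact absurd (by simp [hw', hca, h2 c hcC]) hwc
    have hw'a : 0 < w' a := by
      have := h1 a
      simp only [hw', if_true]
      positivity
    have key := eventually_pos_of_leading_coeff_pos hk
      (γ := fun j ↦ ∑ c ∈ C, w' c * (s * residueCode (p ^ (j + 1)) c
        - s * residueCode (p ^ (j + 1)) y)) ?_ ?_
    · filter_upwards [key] with r hr
      rw [← sub_pos]
      convert hr using 1
      have e1 : s * towerHeight p K r y = ∑ c ∈ C, w' c * (s * towerHeight p K r y) := by
        rw [← Finset.sum_mul, hsum, one_mul]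
      rw [e1, Finset.mul_sum, ← Finset.sum_sub_distrib]
      simp only [towerHeight, Finset.mul_sum]
      rw [Finset.sum_comm (s := Finset.range K)]
      refine Finset.sum_congr rfl fun c _ ↦ ?_
      rw [← Finset.sum_sub_distrib]
      refine Finset.sum_congr rfl fun j _ ↦ ?_
      ring
    · intro j hj
      refine Finset.sum_eq_zero fun c hc ↦ ?_
      by_cases hwc : w' c = 0
      · rw [hwc, zero_mul]
      · rw [residueCode_eq_iff.2 ((hsupp c hc hwc).1.of_dvd (pow_dvd_pow p hj)), sub_self,
          mul_zero]
    · refine Finset.sum_pos' (fun c hc ↦ ?_) ⟨a, ha, mul_pos hw'a (sub_pos.2 hlt)⟩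
      by_cases hwc : w' c = 0
      · rw [hwc, zero_mul]
      · exact mul_nonneg (hw'0 c) (sub_nonneg.2 (hsupp c hc hwc).2)

end Tower

/-! ### Points of the pushed hull above and below the pushed point. -/

section Beyond

variable {d : ℕ} {E : Type*} [AddCommGroup E] [Module ℝ E]

/-- For small perturbations along `e` by the tower heights, the hull of `C` contains a point that
differs from the one of index `y` by a multiple of `e`, of sign `s`. -/
def EventuallyBeyond (p K : ℕ) (s : ℝ) (Q : (Fin d → ℤ) → E) (e : E) (C : Finset (Fin d → ℤ))
    (y : Fin d → ℤ) : Prop :=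
  ∀ᶠ r : ℝ in 𝓝[>] 0, ∃ c : ℝ, s * towerHeight p K r y < s * c ∧
    Q y + c • e ∈ convexHull ℝ ((fun x ↦ Q x + towerHeight p K r x • e) '' C)

variable {p K : ℕ} {s : ℝ} {Q : (Fin d → ℤ) → E} {e : E} {C C' : Finset (Fin d → ℤ)}
  {y : Fin d → ℤ}

theorem EventuallyBeyond.mono (h : EventuallyBeyond p K s Q e C' y) (hC : C' ⊆ C) :
    EventuallyBeyond p K s Q e C y := by
  filter_upwards [h] with r ⟨c, h1, h2⟩
  exact ⟨c, h1, convexHull_mono (Set.image_mono (by exact_mod_cast hC)) h2⟩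

theorem DigitAbove.eventuallyBeyond (h : DigitAbove p K s C C' y) (hC : C' ⊆ C)
    {F : Submodule ℝ E} (hcore : IsCorePoint F (convexHull ℝ (Q '' C')) (Q y))
    (hF : ∀ a ∈ C, Q a - Q y ∈ F) : EventuallyBeyond p K s Q e C y := by
  obtain ⟨w, h1, h2, h3, h4⟩ := h.exists_weights hC hcore hF
  filter_upwards [h4] with r hr
  refine ⟨_, hr, ?_⟩
  rw [← h3]
  exact sum_add_smul_mem_convexHull_image h1 h2

/-- A fixed gap along `e` before the push outweighs all heights, which tend to `0` with `r`. -/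
theorem eventuallyBeyond_of_mem {c : ℝ} (hc : 0 < s * c)
    (h : Q y + c • e ∈ convexHull ℝ (Q '' C)) : EventuallyBeyond p K s Q e C y := by
  obtain ⟨w, h1, -, h3, h4⟩ := exists_weights_of_mem_convexHull_image h
  have hlim : Tendsto (fun r ↦ s * (c + ∑ x ∈ C, w x * towerHeight p K r x)
      - s * towerHeight p K r y) (𝓝[>] 0) (𝓝 (s * (c + ∑ x ∈ C, w x * 0) - s * 0)) :=
    ((tendsto_const_nhds.add (tendsto_finsetSum _ fun x _ ↦
      (tendsto_towerHeight p K x).const_mul (w x))).const_mul s).sub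
      ((tendsto_towerHeight p K y).const_mul s)
  filter_upwards [hlim.eventually (lt_mem_nhds (by simpa using hc))] with r hr
  refine ⟨c + ∑ x ∈ C, w x * towerHeight p K r x, by linarith, ?_⟩
  rw [add_smul, ← add_assoc, ← h4]
  exact sum_add_smul_mem_convexHull_image (fun x _ ↦ h1 x) h3

theorem IsCorePoint.eventually_perturb_of_beyond (hC : C' ⊆ C) {F : Submodule ℝ E}
    (hcore : IsCorePoint F (convexHull ℝ (Q '' C')) (Q y))
    (hup : EventuallyBeyond p K 1 Q e C y) (hlow : EventuallyBeyond p K (-1) Q e C y) :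
    ∀ᶠ r : ℝ in 𝓝[>] 0, IsCorePoint (F ⊔ Submodule.span ℝ {e})
      (convexHull ℝ ((fun x ↦ Q x + towerHeight p K r x • e) '' C))
      (Q y + towerHeight p K r y • e) := by
  filter_upwards [hup, hlow] with r ⟨c, h1, h2⟩ ⟨c', h1', h2'⟩
  exact hcore.perturb hC (h := towerHeight p K r) (by linarith) (by linarith) h2' h2

theorem IsCorePoint.eventually_perturb (hup : DigitAbove p K 1 C C' y)
    (hlow : DigitAbove p K (-1) C C' y) (hC : C' ⊆ C) {F : Submodule ℝ E} (e : E)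
    (hcore : IsCorePoint F (convexHull ℝ (Q '' C')) (Q y)) (hF : ∀ a ∈ C, Q a - Q y ∈ F) :
    ∀ᶠ r : ℝ in 𝓝[>] 0, IsCorePoint (F ⊔ Submodule.span ℝ {e})
      (convexHull ℝ ((fun x ↦ Q x + towerHeight p K r x • e) '' C))
      (Q y + towerHeight p K r y • e) :=
  hcore.eventually_perturb_of_beyond hC (hup.eventuallyBeyond hC hcore hF)
    (hlow.eventuallyBeyond hC hcore hF)

end Beyond

/-! ### Pigeonholing digits to obtain nested sets and admissible residue classes. -/

section Splitting

variable {d : ℕ}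

/-- An integer point, as a point of Euclidean space. -/
noncomputable def latticePoint (x : Fin d → ℤ) : EuclideanSpace ℝ (Fin d) :=
  WithLp.toLp 2 fun i ↦ (x i : ℝ)

@[simp] theorem latticePoint_apply (x : Fin d → ℤ) (i : Fin d) : latticePoint x i = x i := rfl

theorem exists_first_split {p K : ℕ} {C : Finset (Fin d → ℤ)} (hC : 2 ≤ C.card)
    (hK : ∀ x ∈ C, ∀ y ∈ C, LatticeCong (p ^ K) x y → x = y) :
    ∃ k < K, (∀ x ∈ C, ∀ y ∈ C, LatticeCong (p ^ k) x y) ∧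
      ∃ x ∈ C, ∃ y ∈ C, ¬ LatticeCong (p ^ (k + 1)) x y := by
  classical
  have hex : ∃ k, ∃ x ∈ C, ∃ y ∈ C, ¬ LatticeCong (p ^ k) x y := by
    obtain ⟨x, hx, y, hy, hxy⟩ := Finset.one_lt_card.1 hC
    exact ⟨K, x, hx, y, hy, fun h ↦ hxy (hK x hx y hy h)⟩
  obtain ⟨x, hx, y, hy, hxy⟩ := Nat.find_spec hex
  have h0 : Nat.find hex ≠ 0 := fun h ↦ by
    rw [h] at hxy
    exact hxy fun i ↦ by simp
  obtain ⟨k, hk⟩ := Nat.exists_eq_succ_of_ne_zero h0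
  rw [hk] at hxy
  refine ⟨k, ?_, ?_, x, hx, y, hy, hxy⟩
  · have hne : x ≠ y := fun h ↦ hxy (h ▸ LatticeCong.refl _ x)
    have : Nat.find hex ≤ K := Nat.find_min' hex ⟨x, hx, y, hy, fun h ↦ hne (hK x hx y hy h)⟩
    omega
  · have := Nat.find_min hex (m := k) (by omega)
    push Not at this
    exact this

theorem exists_congruent_subset {p k N : ℕ} (hp : 0 < p) {C : Finset (Fin d → ℤ)}
    (hC : N * p ^ d ≤ C.card) (hk : ∀ x ∈ C, ∀ y ∈ C, LatticeCong (p ^ k) x y) :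
    ∃ C' ⊆ C, N ≤ C'.card ∧ ∀ x ∈ C', ∀ y ∈ C', LatticeCong (p ^ (k + 1)) x y := by
  classical
  have : NeZero p := ⟨hp.ne'⟩
  rcases C.eq_empty_or_nonempty with rfl | ⟨a, ha⟩
  · refine ⟨∅, subset_rfl, ?_, by simp⟩
    simp only [Finset.card_empty, nonpos_iff_eq_zero, mul_eq_zero, pow_eq_zero_iff'] at hC
    rcases hC with h | h <;> omega
  -- Relative to the base point `a`, the next base-`p` digits of the `d` coordinates take `p ^ d`
  -- values.
  obtain ⟨y, -, hy⟩ := Finset.exists_le_card_fiber_of_mul_le_card_of_maps_to (s := C)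
    (t := (Finset.univ : Finset (Fin d → ZMod p))) (n := N)
    (f := fun c i ↦ (((c i - a i) / (p ^ k : ℕ) : ℤ) : ZMod p)) (fun _ _ ↦ Finset.mem_univ _)
    ⟨0, Finset.mem_univ _⟩ (by simpa [ZMod.card, mul_comm] using hC)
  refine ⟨_, Finset.filter_subset _ _, hy, fun x hx x' hx' i ↦ ?_⟩
  rw [Finset.mem_filter] at hx hx'
  have h1 := congrFun (hx'.2.trans hx.2.symm) i
  rw [ZMod.intCast_eq_intCast_iff_dvd_sub] at h1
  obtain ⟨u, hu⟩ := hk x hx.1 a ha i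
  obtain ⟨v, hv⟩ := hk x' hx'.1 a ha i
  have hpk : ((p ^ k : ℕ) : ℤ) ≠ 0 := by positivity
  rw [hu, hv, Int.mul_ediv_cancel_left _ hpk, Int.mul_ediv_cancel_left _ hpk] at h1
  obtain ⟨w, hw⟩ := h1
  refine ⟨w, ?_⟩
  have : x i - x' i = (p ^ k : ℕ) * (u - v) := by rw [mul_sub, ← hu, ← hv]; ring
  rw [this, hw]; push_cast; ring

/-- For any `t ∈ D`, all of `D` shares the digit `k` of `y` and `a` lies strictly on side `s` of it,
which settles side `s`. Only side `-s` depends on the choice of `t`, and it is decided at the later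
digit `k'`. -/
theorem exists_split_aux {p K k k' : ℕ} {s : ℝ} (hkk' : k < k') (hk' : k' < K)
    {C D C' : Finset (Fin d → ℤ)} (hD : D ⊆ C) (hC' : C' ⊆ D)
    (hCk : ∀ x ∈ C, ∀ y ∈ C, LatticeCong (p ^ k) x y)
    (hDk : ∀ x ∈ D, ∀ y ∈ D, LatticeCong (p ^ k') x y)
    (hC'k : ∀ x ∈ C', ∀ y ∈ C', LatticeCong (p ^ (k' + 1)) x y)
    {a a' c : Fin d → ℤ} (ha : a ∈ C) (ha' : a' ∈ D) (hc : c ∈ C')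
    (h1 : s * residueCode (p ^ (k + 1)) c < s * residueCode (p ^ (k + 1)) a)
    (h2 : s * residueCode (p ^ (k' + 1)) c ≠ s * residueCode (p ^ (k' + 1)) a') :
    ∃ t ∈ C, ∀ y, LatticeCong (p ^ (k' + 1)) y t →
      DigitAbove p K s C C' y ∧ DigitAbove p K (-s) C C' y := by
  have hcD := hC' hc
  have key : ∀ t ∈ D, ∀ y, LatticeCong (p ^ (k' + 1)) y t →
      (∀ x ∈ D, LatticeCong (p ^ k') x y) ∧ DigitAbove p K s C C' y := by
    intro t ht y hy
    have hD : ∀ x ∈ D, LatticeCong (p ^ k') x y := fun x hx ↦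
      (hDk x hx t ht).trans (hy.symm.of_dvd (pow_dvd_pow p (by omega)))
    have hr : ∀ x ∈ D, residueCode (p ^ (k + 1)) x = residueCode (p ^ (k + 1)) y := fun x hx ↦
      residueCode_eq_iff.2 ((hD x hx).of_dvd (pow_dvd_pow p (by omega)))
    refine ⟨hD, k, by omega, fun x hx ↦ ⟨(hD x (hC' hx)).of_dvd (pow_dvd_pow p (by omega)), ?_⟩,
      a, ha, (hCk a ha c (by aesop)).trans ((hD c hcD).of_dvd (pow_dvd_pow p (by omega))), ?_⟩
    · rw [hr x (hC' hx)]
    · rw [← hr c hcD]; exact h1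
  -- Of `c` and `a'`, take as `t` the one further on side `s`: then no point of `C'` is beyond `y`
  -- on that side at digit `k'`, and the other one is strictly on side `-s`.
  rcases lt_or_gt_of_ne h2 with h2 | h2
  · refine ⟨a', hD ha', fun y hy ↦ ⟨(key a' ha' y hy).2, k', hk', fun x hx ↦
      ⟨(key a' ha' y hy).1 x (hC' hx), ?_⟩, c, hD hcD, (key a' ha' y hy).1 c hcD, ?_⟩⟩
    · rw [residueCode_eq_iff.2 hy, residueCode_eq_iff.2 (hC'k x hx c hc)]; linarith
    · rw [residueCode_eq_iff.2 hy]; linarith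
  · refine ⟨c, hD hcD, fun y hy ↦ ⟨(key c hcD y hy).2, k', hk', fun x hx ↦
      ⟨(key c hcD y hy).1 x (hC' hx), ?_⟩, a', hD ha', (key c hcD y hy).1 a' ha', ?_⟩⟩
    · rw [residueCode_eq_iff.2 hy, residueCode_eq_iff.2 (hC'k x hx c hc)]
    · rw [residueCode_eq_iff.2 hy]; linarith

/-- Two successive splittings, each followed by passing to a largest digit class, cost the factor `p
^ (2 * d)`. -/
theorem exists_split {p K N : ℕ} (hp : 0 < p) (hN : 2 ≤ N) {C : Finset (Fin d → ℤ)}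
    (hC : N * p ^ (2 * d) ≤ C.card)
    (hK : ∀ x ∈ C, ∀ y ∈ C, LatticeCong (p ^ K) x y → x = y) :
    ∃ C' ⊆ C, N ≤ C'.card ∧ ∃ t ∈ C, ∃ m, (∀ x ∈ C', ∀ y ∈ C', LatticeCong (p ^ m) x y) ∧
      ∀ y, LatticeCong (p ^ m) y t → DigitAbove p K 1 C C' y ∧ DigitAbove p K (-1) C C' y := by
  have hpd : 1 ≤ p ^ d := Nat.one_le_pow _ _ hp
  have hC2 : N * p ^ d * p ^ d ≤ C.card := by rwa [mul_assoc, ← pow_add, ← two_mul]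
  have h1 : N ≤ N * p ^ d := Nat.le_mul_of_pos_right _ hpd
  have h2 : N * p ^ d ≤ N * p ^ d * p ^ d := Nat.le_mul_of_pos_right _ hpd
  obtain ⟨k, hk, hCk, x, hx, x', hx', hxx'⟩ := exists_first_split (by omega) hK
  obtain ⟨D, hDC, hDN, hDk⟩ := exists_congruent_subset hp hC2 hCk
  obtain ⟨k', hk', hDk', z, hz, z', hz', hzz'⟩ := exists_first_split (by omega)
    fun x hx y hy ↦ hK x (hDC hx) y (hDC hy)
  obtain ⟨C', hC'D, hC'N, hC'k⟩ := exists_congruent_subset hp hDN hDk'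
  obtain ⟨c, hc⟩ : C'.Nonempty := Finset.card_pos.1 (by omega)
  have hkk' : k < k' := by
    by_contra! h
    exact hzz' ((hDk z hz z' hz').of_dvd (pow_dvd_pow p (by omega)))
  have ha : ∃ a ∈ C, ¬ LatticeCong (p ^ (k + 1)) c a := by
    by_contra! h
    exact hxx' ((h x hx).symm.trans (h x' hx'))
  have ha' : ∃ a ∈ D, ¬ LatticeCong (p ^ (k' + 1)) c a := by
    by_contra! h
    exact hzz' ((h z hz).symm.trans (h z' hz'))
  obtain ⟨a, haC, ha⟩ := ha
  obtain ⟨a', haD, ha'⟩ := ha'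
  rw [← residueCode_eq_iff] at ha ha'
  refine ⟨C', hC'D.trans hDC, hC'N, ?_⟩
  rcases lt_or_gt_of_ne ha with h | h
  · obtain ⟨t, ht, hy⟩ := exists_split_aux (s := 1) hkk' hk' hDC hC'D hCk hDk' hC'k haC haD hc
      (by linarith) (by simpa using ha')
    exact ⟨t, ht, k' + 1, hC'k, hy⟩
  · obtain ⟨t, ht, hy⟩ := exists_split_aux (s := -1) hkk' hk' hDC hC'D hCk hDk' hC'k haC haD hc
      (by linarith) (by simpa using ha')
    exact ⟨t, ht, k' + 1, hC'k, fun y h ↦ ⟨by simpa using (hy y h).2, (hy y h).1⟩⟩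

/-- `y` can be placed strictly inside the hull of `C` by the first `i` perturbations. -/
def Admissible (p : ℕ → ℕ) (K : ℕ) : ℕ → Finset (Fin d → ℤ) → (Fin d → ℤ) → Prop
  | 0, C, y => IsCorePoint (vectorSpan ℝ (latticePoint '' (C : Set (Fin d → ℤ))))
      (convexHull ℝ (latticePoint '' (C : Set (Fin d → ℤ)))) (latticePoint y)
  | i + 1, C, y => ∃ C' ⊆ C,
      vectorSpan ℝ (latticePoint '' (C' : Set (Fin d → ℤ))) =
        vectorSpan ℝ (latticePoint '' (C : Set (Fin d → ℤ))) ∧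
      Admissible p K i C' y ∧ DigitAbove (p i) K 1 C C' y ∧ DigitAbove (p i) K (-1) C C' y

/-- The outermost splitting belongs to the last prime, matching the recursion in `Admissible`.
Equality of the extreme spans forces equality for every set in between. -/
theorem exists_chain {p : ℕ → ℕ} (hp : ∀ i, 0 < p i) {K N : ℕ} (hN : 2 ≤ N) (i : ℕ)
    {C : Finset (Fin d → ℤ)} (hC : N * ∏ j ∈ Finset.range i, p j ^ (2 * d) ≤ C.card)
    (hK : ∀ j, ∀ x ∈ C, ∀ y ∈ C, LatticeCong (p j ^ K) x y → x = y) :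
    ∃ B ⊆ C, N ≤ B.card ∧ ∃ (t : ℕ → Fin d → ℤ) (m : ℕ → ℕ), (∀ j < i, t j ∈ C) ∧
      (∀ j < i, ∀ x ∈ B, ∀ y ∈ B, LatticeCong (p j ^ m j) x y) ∧
      ∀ y, (∀ j < i, LatticeCong (p j ^ m j) y (t j)) →
        vectorSpan ℝ (latticePoint '' (B : Set (Fin d → ℤ))) =
          vectorSpan ℝ (latticePoint '' (C : Set (Fin d → ℤ))) →
        Admissible p K 0 B y → Admissible p K i C y := by
  induction i generalizing C with
  | zero =>
    exact ⟨C, subset_rfl, by simpa using hC, fun _ _ ↦ 0, fun _ ↦ 0, by simp, by simp,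
      fun y _ _ h ↦ h⟩
  | succ i ih =>
    have hpos : 0 < ∏ j ∈ Finset.range i, p j ^ (2 * d) :=
      Finset.prod_pos fun j _ ↦ pow_pos (hp j) _
    rw [Finset.prod_range_succ, ← mul_assoc] at hC
    obtain ⟨C', hC'C, hC'N, t₀, ht₀, m₀, hm₀, hy₀⟩ := exists_split (K := K) (hp i)
      (hN.trans (Nat.le_mul_of_pos_right N hpos)) hC (hK i)
    obtain ⟨B, hBC, hBN, t, m, ht, hm, hy⟩ := ih hC'N
      fun j x hx y hy ↦ hK j x (hC'C hx) y (hC'C hy)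
    refine ⟨B, hBC.trans hC'C, hBN, fun j ↦ if j = i then t₀ else t j,
      fun j ↦ if j = i then m₀ else m j, fun j hj ↦ ?_, fun j hj ↦ ?_, fun y hyt hspan hadm ↦ ?_⟩
    · dsimp only
      split_ifs with h
      · exact ht₀
      · exact hC'C (ht j (by omega))
    · dsimp only
      split_ifs with h
      · subst h
        exact fun x hx y hy ↦ hm₀ x (hBC hx) y (hBC hy)
      · exact hm j (by omega)
    · have h1 : vectorSpan ℝ (latticePoint '' (B : Set (Fin d → ℤ))) ≤
          vectorSpan ℝ (latticePoint '' (C' : Set (Fin d → ℤ))) :=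
        vectorSpan_mono ℝ (Set.image_mono (by exact_mod_cast hBC))
      have h2 : vectorSpan ℝ (latticePoint '' (C' : Set (Fin d → ℤ))) ≤
          vectorSpan ℝ (latticePoint '' (C : Set (Fin d → ℤ))) :=
        vectorSpan_mono ℝ (Set.image_mono (by exact_mod_cast hC'C))
      refine ⟨C', hC'C, le_antisymm h2 (hspan ▸ h1), hy y (fun j hj ↦ ?_)
        (le_antisymm h1 (hspan ▸ h2)) hadm, hy₀ y ?_⟩
      · have := hyt j (by omega)
        simpa [show j ≠ i by omega] using this
      · have := hyt i (by omega)
        simpa using this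

/-- If the span of `B` is smaller than that of `C`, start again from `B`. Dimension at most `s`
allows `s` restarts, whence the exponent `s + 1`. -/
theorem exists_chain_vectorSpan_eq {p : ℕ → ℕ} (hp : ∀ i, 0 < p i) {K : ℕ} (i s : ℕ)
    {C : Finset (Fin d → ℤ)}
    (hs : Module.finrank ℝ (vectorSpan ℝ (latticePoint '' (C : Set (Fin d → ℤ)))) ≤ s)
    (hC : 2 * (∏ j ∈ Finset.range i, p j ^ (2 * d)) ^ (s + 1) ≤ C.card)
    (hK : ∀ j, ∀ x ∈ C, ∀ y ∈ C, LatticeCong (p j ^ K) x y → x = y) :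
    ∃ C' ⊆ C, ∃ B ⊆ C', 2 ≤ B.card ∧ ∃ (t : ℕ → Fin d → ℤ) (m : ℕ → ℕ), (∀ j < i, t j ∈ C') ∧
      vectorSpan ℝ (latticePoint '' (B : Set (Fin d → ℤ))) =
          vectorSpan ℝ (latticePoint '' (C' : Set (Fin d → ℤ))) ∧
      (∀ j < i, ∀ x ∈ B, ∀ y ∈ B, LatticeCong (p j ^ m j) x y) ∧
      ∀ y, (∀ j < i, LatticeCong (p j ^ m j) y (t j)) →
        Admissible p K 0 B y → Admissible p K i C' y := by
  have hpos : 0 < ∏ j ∈ Finset.range i, p j ^ (2 * d) :=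
      Finset.prod_pos fun j _ ↦ pow_pos (hp j) _
  induction s generalizing C with
  | zero =>
    obtain ⟨B, hBC, hBN, t, m, ht, hm, hy⟩ := exists_chain hp (K := K) le_rfl i
      (by simpa using hC) hK
    have h1 : vectorSpan ℝ (latticePoint '' (B : Set (Fin d → ℤ))) ≤
        vectorSpan ℝ (latticePoint '' (C : Set (Fin d → ℤ))) :=
      vectorSpan_mono ℝ (Set.image_mono (by exact_mod_cast hBC))
    have h2 : vectorSpan ℝ (latticePoint '' (C : Set (Fin d → ℤ))) = ⊥ :=
      Submodule.finrank_eq_zero.1 (by omega)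
    have h3 : vectorSpan ℝ (latticePoint '' (B : Set (Fin d → ℤ))) =
        vectorSpan ℝ (latticePoint '' (C : Set (Fin d → ℤ))) := by
      rw [h2] at h1 ⊢; exact le_bot_iff.1 h1
    exact ⟨C, subset_rfl, B, hBC, hBN, t, m, ht, h3, hm, fun y h h' ↦ hy y h h3 h'⟩
  | succ s ih =>
    rw [pow_succ, ← mul_assoc] at hC
    obtain ⟨B, hBC, hBN, t, m, ht, hm, hy⟩ := exists_chain hp (K := K)
      (Nat.le_mul_of_pos_right 2 (pow_pos hpos (s + 1))) i hC hK
    have h1 : vectorSpan ℝ (latticePoint '' (B : Set (Fin d → ℤ))) ≤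
        vectorSpan ℝ (latticePoint '' (C : Set (Fin d → ℤ))) :=
      vectorSpan_mono ℝ (Set.image_mono (by exact_mod_cast hBC))
    rcases h1.eq_or_lt with h3 | h3
    · exact ⟨C, subset_rfl, B, hBC,
        (Nat.le_mul_of_pos_right 2 (pow_pos hpos (s + 1))).trans hBN, t, m, ht, h3, hm,
        fun y h h' ↦ hy y h h3 h'⟩
    · have := Submodule.finrank_lt_finrank_of_lt h3
      obtain ⟨C', hC', h⟩ := ih (by omega) hBN fun j x hx y hy ↦ hK j x (hBC hx) y (hBC hy)
      exact ⟨C', hC'.trans hBC, h⟩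

end Splitting

/-! ### Lattice points with prescribed residues in the relative interior of a hull. -/

theorem Convex.add_sum_smul_sub_mem {E ι : Type*} [AddCommGroup E] [Module ℝ E] [Fintype ι]
    {G : Set E} (hG : Convex ℝ G) {a : E} (ha : a ∈ G) {g : ι → E} (hg : ∀ j, g j ∈ G)
    {θ : ι → ℝ} (h0 : ∀ j, 0 ≤ θ j) (h1 : ∑ j, θ j ≤ 1) : a + ∑ j, θ j • (g j - a) ∈ G := by
  have := hG.sum_mem (t := Finset.univ) (w := fun o : Option ι ↦ o.elim (1 - ∑ j, θ j) θ)
    (z := fun o ↦ o.elim a g) ?_ ?_ ?_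
  · convert this using 1
    rw [Fintype.sum_option]
    simp only [Option.elim, smul_sub, Finset.sum_sub_distrib, sub_smul, Finset.sum_smul, one_smul]
    abel
  · rintro (_ | j) _
    · simpa using h1
    · exact h0 j
  · rw [Fintype.sum_option]; simp
  · rintro (_ | j) _
    · exact ha
    · exact hg j

/-- Interpolation between a point and others, with positive weights of sum less than one, gives a
core point in the span of the directions. -/
theorem isCorePoint_add_sum {E ι : Type*} [AddCommGroup E] [Module ℝ E] [Fintype ι]
    {G : Set E} (hG : Convex ℝ G) {a : E} (ha : a ∈ G) {g : ι → E} (hg : ∀ j, g j ∈ G)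
    {θ : ι → ℝ} (h0 : ∀ j, 0 < θ j) (h1 : ∑ j, θ j < 1) :
    IsCorePoint (Submodule.span ℝ (Set.range fun j ↦ g j - a)) G (a + ∑ j, θ j • (g j - a)) := by
  intro v hv
  obtain ⟨u, rfl⟩ := (Submodule.mem_span_range_iff_exists_fun ℝ).1 hv
  have h2 : ∀ᶠ τ : ℝ in 𝓝[>] 0, ∀ j, 0 < θ j + τ * u j := by
    refine eventually_all.2 fun j ↦ ?_
    have hc : Continuous fun τ : ℝ ↦ θ j + τ * u j := by fun_prop
    have := (hc.tendsto 0).mono_left (nhdsWithin_le_nhds (s := Set.Ioi 0))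
    exact this.eventually (lt_mem_nhds (by simpa using h0 j))
  have h3 : ∀ᶠ τ : ℝ in 𝓝[>] 0, ∑ j, (θ j + τ * u j) < 1 := by
    have hc : Continuous fun τ : ℝ ↦ ∑ j, (θ j + τ * u j) := by fun_prop
    have := (hc.tendsto 0).mono_left (nhdsWithin_le_nhds (s := Set.Ioi 0))
    exact this.eventually (gt_mem_nhds (by simpa using h1))
  obtain ⟨τ, h2, h3, h4⟩ := (h2.and (h3.and self_mem_nhdsWithin)).exists
  refine ⟨τ, h4, ?_⟩
  have := hG.add_sum_smul_sub_mem ha hg (fun j ↦ (h2 j).le) h3.le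
  convert this using 1
  simp only [add_smul, Finset.sum_add_distrib, Finset.smul_sum, smul_smul, add_assoc]

section Target

variable {d : ℕ}

theorem latticePoint_sub (x y : Fin d → ℤ) :
    latticePoint (x - y) = latticePoint x - latticePoint y := by
  ext i; simp

theorem latticePoint_add (x y : Fin d → ℤ) :
    latticePoint (x + y) = latticePoint x + latticePoint y := by
  ext i; simp

theorem latticePoint_zsmul (n : ℤ) (x : Fin d → ℤ) :
    latticePoint (n • x) = (n : ℝ) • latticePoint x := by
  ext i; simp

theorem latticePoint_sum {ι : Type*} (s : Finset ι) (f : ι → Fin d → ℤ) :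
    latticePoint (∑ j ∈ s, f j) = ∑ j ∈ s, latticePoint (f j) := by
  ext i; simp [WithLp.ofLp_sum]

theorem exists_chinese_weights {q : ℕ → ℕ} (i : ℕ)
    (hq : ∀ j < i, ∀ k < i, j ≠ k → Nat.Coprime (q j) (q k)) :
    ∀ k < i, ∃ c : ℤ, (q k : ℤ) ∣ c - 1 ∧ ∀ j < i, j ≠ k → (q j : ℤ) ∣ c := by
  intro k hk
  have hcop : Nat.Coprime (∏ j ∈ (Finset.range i).erase k, q j) (q k) := by
    refine Nat.Coprime.prod_left fun j hj ↦ ?_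
    rw [Finset.mem_erase, Finset.mem_range] at hj
    exact hq j hj.2 k hk hj.1
  obtain ⟨a, b, hab⟩ := Nat.isCoprime_iff_coprime.2 hcop
  refine ⟨a * (∏ j ∈ (Finset.range i).erase k, q j : ℕ), ⟨-b, by linarith⟩, fun j hj hjk ↦ ?_⟩
  refine Dvd.dvd.mul_left (Int.natCast_dvd_natCast.2 (Finset.dvd_prod_of_mem q ?_)) a
  rw [Finset.mem_erase, Finset.mem_range]
  exact ⟨hjk, hj⟩

/-- The vectors `w j = (b j - a) / M` are integral, and still divisible by every `q k` since `q k`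
is prime to `M`. Hence a solution `a + v` of the congruences may be translated by them. This reduces
its coordinates along `b j - a` to at most `1 / M` each, and there are at most `d < M` of them. -/
theorem exists_core_latticePoint {M : ℕ} (hM : d < M) {i : ℕ} {q : ℕ → ℕ}
    (hq : ∀ j < i, ∀ k < i, j ≠ k → Nat.Coprime (q j) (q k))
    (hqM : ∀ j < i, Nat.Coprime (q j) M) {B C : Finset (Fin d → ℤ)} (hB : B.Nonempty) (hBC : B ⊆ C)
    (hspan : vectorSpan ℝ (latticePoint '' (B : Set (Fin d → ℤ))) =
      vectorSpan ℝ (latticePoint '' (C : Set (Fin d → ℤ))))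
    (hBM : ∀ x ∈ B, ∀ y ∈ B, LatticeCong M x y)
    (hBq : ∀ j < i, ∀ x ∈ B, ∀ y ∈ B, LatticeCong (q j) x y)
    {t : ℕ → Fin d → ℤ} (ht : ∀ j < i, t j ∈ C) :
    ∃ y, (∀ j < i, LatticeCong (q j) y (t j)) ∧
      IsCorePoint (vectorSpan ℝ (latticePoint '' (B : Set (Fin d → ℤ))))
        (convexHull ℝ (latticePoint '' (B : Set (Fin d → ℤ)))) (latticePoint y) := by
  obtain ⟨a, ha⟩ := hB
  have hM0 : (M : ℝ) ≠ 0 := by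
    have : 0 < M := by omega
    positivity
  obtain ⟨f, hfS, hfspan, hfind⟩ := Submodule.exists_fun_fin_finrank_span_eq ℝ
    ((fun x ↦ latticePoint x - latticePoint a) '' (B : Set (Fin d → ℤ)))
  generalize Module.finrank ℝ (Submodule.span ℝ
    ((fun x ↦ latticePoint x - latticePoint a) '' (B : Set (Fin d → ℤ)))) = m at f hfS hfspan hfind
  have hm : m ≤ d := by
    have := hfind.fintype_card_le_finrank
    simpa using this
  choose b hbB hbf using hfS
  replace hbf : ∀ j, latticePoint (b j) - latticePoint a = f j := hbf
  have hW : vectorSpan ℝ (latticePoint '' (B : Set (Fin d → ℤ))) =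
      Submodule.span ℝ (Set.range f) := by
    rw [hfspan, vectorSpan_eq_span_vsub_set_right ℝ (Set.mem_image_of_mem latticePoint
      (show a ∈ (B : Set (Fin d → ℤ)) from ha)), Set.image_image]
    rfl
  -- divide the directions by `M`
  have hw : ∀ j, ∃ w : Fin d → ℤ, b j - a = (M : ℤ) • w := fun j ↦ by
    choose w hw using hBM _ (hbB j) a ha
    exact ⟨w, funext fun k ↦ by simpa using hw k⟩
  choose w hw using hw
  have hwf : ∀ j, f j = (M : ℝ) • latticePoint (w j) := fun j ↦ by
    have := congrArg latticePoint (hw j)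
    rw [latticePoint_sub, latticePoint_zsmul] at this
    rw [← hbf, this, Int.cast_natCast]
  have hwq : ∀ k < i, ∀ j l, (q k : ℤ) ∣ w j l := fun k hk j l ↦ by
    have h1 := hBq k hk _ (hbB j) a ha l
    have h2 : b j l - a l = M * w j l := by simpa using congrFun (hw j) l
    rw [h2] at h1
    exact (Nat.isCoprime_iff_coprime.2 (hqM k hk)).dvd_of_dvd_mul_left h1
  -- solve the congruences in the direction of `B`
  have hc := exists_chinese_weights i hq
  choose! c hc1 hc0 using hc
  set v : Fin d → ℤ := ∑ k ∈ Finset.range i, c k • (t k - a) with hv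
  have hvW : latticePoint v ∈ Submodule.span ℝ (Set.range f) := by
    rw [← hW, hspan, hv, latticePoint_sum]
    refine Submodule.sum_mem _ fun k hk ↦ ?_
    rw [latticePoint_zsmul, latticePoint_sub]
    exact Submodule.smul_mem _ _ (vsub_mem_vectorSpan ℝ
      (Set.mem_image_of_mem _ (ht k (Finset.mem_range.1 hk))) (Set.mem_image_of_mem _ (hBC ha)))
  obtain ⟨x, hx⟩ := (Submodule.mem_span_range_iff_exists_fun ℝ).1 hvW
  -- The ceiling minus one, rather than the floor, puts `θ j` in `(0, 1 / M]`, so it stays positive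
  -- when `M * x j` is an integer.
  set n : Fin m → ℤ := fun j ↦ ⌈M * x j⌉ - 1 with hn
  set θ : Fin m → ℝ := fun j ↦ (M * x j - n j) / M with hθ
  have hθ0 : ∀ j, 0 < θ j := fun j ↦ by
    have h1 := Int.ceil_lt_add_one (M * x j)
    have : 0 < M * x j - n j := by simp only [hn]; push_cast; linarith
    have : (0 : ℝ) < M := by have : 0 < M := by omega
                             positivity
    positivity
  have hθ1 : ∑ j, θ j < 1 := by
    have hMpos : (0 : ℝ) < M := by have : 0 < M := by omega
                                   positivity
    have h2 : ∀ j, θ j ≤ 1 / M := fun j ↦ by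
      have h1 := Int.le_ceil (M * x j)
      refine div_le_div_of_nonneg_right ?_ hMpos.le
      simp only [hn]; push_cast; linarith
    calc ∑ j, θ j ≤ ∑ _j : Fin m, 1 / (M : ℝ) := Finset.sum_le_sum fun j _ ↦ h2 j
      _ = m / M := by simp [div_eq_mul_inv]
      _ < 1 := by
        rw [div_lt_one hMpos]
        exact_mod_cast lt_of_le_of_lt hm hM
  refine ⟨a + v - ∑ j, n j • w j, fun k hk l ↦ ?_, ?_⟩
  · have h1 : (q k : ℤ) ∣ ∑ j, n j * w j l :=
      Finset.dvd_sum fun j _ ↦ (hwq k hk j l).mul_left _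
    have h2 : (q k : ℤ) ∣ v l - (t k l - a l) := by
      have : v l - (t k l - a l) = (c k - 1) * (t k l - a l)
          + ∑ k' ∈ (Finset.range i).erase k, c k' * (t k' l - a l) := by
        have h3 : v l = ∑ k' ∈ Finset.range i, c k' * (t k' l - a l) := by simp [hv]
        rw [h3, ← Finset.add_sum_erase _ _ (Finset.mem_range.2 hk)]
        ring
      rw [this]
      refine ((hc1 k hk).mul_right _).add (Finset.dvd_sum fun k' hk' ↦ ?_)
      rw [Finset.mem_erase, Finset.mem_range] at hk'
      exact (hc0 k' hk'.2 k hk hk'.1.symm).mul_right _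
    have h4 : (a + v - ∑ j, n j • w j) l - t k l =
        (v l - (t k l - a l)) - ∑ j, n j * w j l := by
      simp; ring
    rw [h4]
    exact h2.sub h1
  · rw [hW]
    have hg := isCorePoint_add_sum (convex_convexHull ℝ (latticePoint '' (B : Set (Fin d → ℤ))))
      (subset_convexHull ℝ _ (Set.mem_image_of_mem latticePoint ha))
      (g := fun j ↦ latticePoint (b j))
      (fun j ↦ subset_convexHull ℝ _ (Set.mem_image_of_mem latticePoint (hbB j))) hθ0 hθ1
    have hbf' : (fun j ↦ latticePoint (b j) - latticePoint a) = f := funext hbf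
    rw [hbf'] at hg
    convert hg using 1
    rw [latticePoint_sub, latticePoint_add, ← hx, latticePoint_sum, add_sub_assoc,
      ← Finset.sum_sub_distrib]
    congr 1
    refine Finset.sum_congr rfl fun j _ ↦ ?_
    simp only [hbf, hθ]
    rw [latticePoint_zsmul, hwf j, smul_smul, smul_smul, ← sub_smul]
    congr 1
    field_simp

end Target

/-! ### Successive pushes of the lattice box and the general-dimension theorem. -/

section Perturbation

variable {d : ℕ}

/-- The integer points of the cube `[1, n]^d`. -/
noncomputable def latticeBox (d n : ℕ) : Finset (Fin d → ℤ) := Fintype.piFinset fun _ ↦ Finset.Icc 1 (n : ℤ)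

theorem mem_latticeBox {n : ℕ} {x : Fin d → ℤ} : x ∈ latticeBox d n ↔ ∀ i, 1 ≤ x i ∧ x i ≤ n := by
  simp [latticeBox]

theorem eq_of_latticeCong_pow {p n : ℕ} (hp : 1 < p) {x y : Fin d → ℤ} (hx : x ∈ latticeBox d n)
    (hy : y ∈ latticeBox d n) (h : LatticeCong (p ^ n) x y) : x = y := by
  rw [mem_latticeBox] at hx hy
  funext i
  have h1 : (n : ℤ) < (p ^ n : ℕ) := by exact_mod_cast Nat.lt_pow_self hp
  have h2 := Int.eq_zero_of_abs_lt_dvd (h i) (by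
    rw [abs_lt]; constructor <;> linarith [(hx i).1, (hx i).2, (hy i).1, (hy i).2])
  linarith

theorem mem_latticeBox_of_mem_convexHull {n : ℕ} {B : Finset (Fin d → ℤ)} (hB : B ⊆ latticeBox d n)
    {y : Fin d → ℤ}
    (hy : latticePoint y ∈ convexHull ℝ (latticePoint '' (B : Set (Fin d → ℤ)))) :
    y ∈ latticeBox d n := by
  obtain ⟨w, h1, -, h3, h4⟩ := exists_weights_of_mem_convexHull_image hy
  rw [mem_latticeBox]
  intro i
  have h5 : ∑ x ∈ B, w x * (x i : ℝ) = y i := by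
    have := congrArg (fun z : EuclideanSpace ℝ (Fin d) ↦ z i) h4
    simpa [WithLp.ofLp_sum] using this
  have h6 : ∀ x ∈ B, (1 : ℝ) ≤ x i ∧ (x i : ℝ) ≤ n := fun x hx ↦ by
    have := mem_latticeBox.1 (hB hx) i
    exact_mod_cast this
  constructor
  · have : (1 : ℝ) ≤ y i := by
      rw [← h5, ← h3]
      exact Finset.sum_le_sum fun x hx ↦ by nlinarith [h1 x, (h6 x hx).1]
    exact_mod_cast this
  · have : (y i : ℝ) ≤ n := by
      rw [← h5, ← one_mul (n : ℝ), ← h3, Finset.sum_mul]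
      exact Finset.sum_le_sum fun x hx ↦ by nlinarith [h1 x, (h6 x hx).2]
    exact_mod_cast this

theorem Admissible.mem_convexHull {p : ℕ → ℕ} {K i : ℕ} {C : Finset (Fin d → ℤ)} {y : Fin d → ℤ}
    (h : Admissible p K i C y) :
    latticePoint y ∈ convexHull ℝ (latticePoint '' (C : Set (Fin d → ℤ))) := by
  induction i generalizing C with
  | zero => exact IsCorePoint.mem h
  | succ i ih =>
    obtain ⟨C', hC', -, h, -⟩ := h
    exact convexHull_mono (Set.image_mono (by exact_mod_cast hC')) (ih h)

theorem sub_mem_vectorSpan_of_mem_convexHull {E : Type*} [AddCommGroup E] [Module ℝ E] {S : Set E}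
    {a y : E} (ha : a ∈ S) (hy : y ∈ convexHull ℝ S) : a - y ∈ vectorSpan ℝ S := by
  rw [← direction_affineSpan]
  exact AffineSubspace.vsub_mem_direction (subset_affineSpan ℝ S ha)
    (convexHull_subset_affineSpan S hy)

/-- The box has finitely many subsets and points, so one small `r` serves all pairs `(C, y)` at each
stage. Each push is chosen after the preceding ones are fixed. -/
theorem exists_perturbation (X : Finset (Fin d → ℤ)) (p : ℕ → ℕ) (K : ℕ) {ε : ℝ} (hε : 0 < ε)
    (e : ℕ → EuclideanSpace ℝ (Fin d)) (i : ℕ) :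
    ∃ Q : (Fin d → ℤ) → EuclideanSpace ℝ (Fin d), (∀ x ∈ X, ‖Q x - latticePoint x‖ < ε) ∧
      (∀ x, Q x - latticePoint x ∈ Submodule.span ℝ (e '' Set.Iio i)) ∧
      ∀ C ⊆ X, ∀ y ∈ X, Admissible p K i C y →
        IsCorePoint (vectorSpan ℝ (latticePoint '' (C : Set (Fin d → ℤ))) ⊔
          Submodule.span ℝ (e '' Set.Iio i)) (convexHull ℝ (Q '' (C : Set (Fin d → ℤ)))) (Q y) := by
  induction i with
  | zero =>
    refine ⟨latticePoint, by simpa using fun _ _ ↦ hε, by simp, fun C _ y _ h ↦ ?_⟩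
    simpa [Admissible] using h
  | succ i ih =>
    obtain ⟨Q, hQε, hQ, hQA⟩ := ih
    have hspan : Submodule.span ℝ (e '' Set.Iio (i + 1)) =
        Submodule.span ℝ (e '' Set.Iio i) ⊔ Submodule.span ℝ {e i} := by
      rw [← Submodule.span_union]
      congr 1
      ext z
      simp only [Set.mem_image, Set.mem_Iio, Set.mem_union, Set.mem_singleton_iff,
        Nat.lt_succ_iff_lt_or_eq]
      constructor
      · rintro ⟨j, h | rfl, rfl⟩
        · exact Or.inl ⟨j, h, rfl⟩
        · exact Or.inr rfl
      · rintro (⟨j, h, rfl⟩ | rfl)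
        · exact ⟨j, Or.inl h, rfl⟩
        · exact ⟨i, Or.inr rfl, rfl⟩
    have h1 : ∀ᶠ r in 𝓝[>] 0, ∀ x ∈ X,
        ‖Q x + towerHeight (p i) K r x • e i - latticePoint x‖ < ε := by
      rw [eventually_all_finset]
      intro x hx
      have := ((((tendsto_towerHeight (p i) K x).smul_const (e i)).const_add (Q x)).sub_const
        (latticePoint x)).norm
      rw [zero_smul, add_zero] at this
      exact this.eventually (gt_mem_nhds (hQε x hx))
    have h2 : ∀ᶠ r in 𝓝[>] 0, ∀ C ∈ X.powerset, ∀ y ∈ X, Admissible p K (i + 1) C y →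
        IsCorePoint (vectorSpan ℝ (latticePoint '' (C : Set (Fin d → ℤ))) ⊔
          Submodule.span ℝ (e '' Set.Iio (i + 1)))
          (convexHull ℝ ((fun x ↦ Q x + towerHeight (p i) K r x • e i) '' (C : Set (Fin d → ℤ))))
          (Q y + towerHeight (p i) K r y • e i) := by
      rw [eventually_all_finset]
      intro C hC
      rw [Finset.mem_powerset] at hC
      rw [eventually_all_finset]
      intro y hy
      by_cases hadm : Admissible p K (i + 1) C y
      · obtain ⟨C', hC', hV, hadm', hup, hlow⟩ := id hadm
        have hcore := hQA C' (hC'.trans hC) y hy hadm'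
        rw [hV] at hcore
        have hF : ∀ a ∈ C, Q a - Q y ∈ vectorSpan ℝ (latticePoint '' (C : Set (Fin d → ℤ))) ⊔
            Submodule.span ℝ (e '' Set.Iio i) := fun a ha ↦ by
          have e1 : Q a - Q y = (latticePoint a - latticePoint y) +
              ((Q a - latticePoint a) - (Q y - latticePoint y)) := by abel
          rw [e1]
          exact Submodule.add_mem_sup (sub_mem_vectorSpan_of_mem_convexHull
            (Set.mem_image_of_mem _ ha) hadm.mem_convexHull)
            (Submodule.sub_mem _ (hQ a) (hQ y))
        filter_upwards [hcore.eventually_perturb hup hlow hC' (e i) hF] with r hr _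
        rw [hspan, ← sup_assoc]
        exact hr
      · exact Eventually.of_forall fun r h ↦ absurd h hadm
    obtain ⟨r, h1, h2⟩ := (h1.and h2).exists
    refine ⟨fun x ↦ Q x + towerHeight (p i) K r x • e i, h1, fun x ↦ ?_,
      fun C hC ↦ h2 C (Finset.mem_powerset.2 hC)⟩
    have e1 : Q x + towerHeight (p i) K r x • e i - latticePoint x =
        (Q x - latticePoint x) + towerHeight (p i) K r x • e i := by abel
    rw [hspan, e1]
    exact Submodule.add_mem_sup (hQ x) (Submodule.smul_mem _ _ (Submodule.mem_span_singleton_self _))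

/-- The last factor is `M ^ d`, the number of residue classes modulo `M`; the power `d + 1` pays for
dimension drops; the `2` leaves two points in `B`. -/
theorem exists_interior_perturbation (n : ℕ) {p : ℕ → ℕ} (hp : ∀ i, (p i).Prime)
    (hinj : Function.Injective p) {ε : ℝ} (hε : 0 < ε) {ℓ : ℕ}
    (hℓ : 2 * (∏ j ∈ Finset.range d, p j ^ (2 * d)) ^ (d + 1) *
      (d * ∏ j ∈ Finset.range d, p j + 1) ^ d ≤ ℓ) :
    ∃ Q : (Fin d → ℤ) → EuclideanSpace ℝ (Fin d),
      (∀ x ∈ latticeBox d n, ‖Q x - latticePoint x‖ < ε) ∧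
      ∀ A ⊆ latticeBox d n, A.card = ℓ → ∃ y ∈ latticeBox d n,
        Q y ∈ interior (convexHull ℝ (Q '' (A : Set (Fin d → ℤ)))) := by
  set M := d * ∏ j ∈ Finset.range d, p j + 1 with hM
  have hdM : d < M := by
    have : 0 < ∏ j ∈ Finset.range d, p j := Finset.prod_pos fun j _ ↦ (hp j).pos
    have := Nat.le_mul_of_pos_right d this
    omega
  have hpM : ∀ j < d, Nat.Coprime (p j) M := fun j hj ↦ by
    have h1 : p j ∣ d * ∏ j ∈ Finset.range d, p j :=
      (Finset.dvd_prod_of_mem p (Finset.mem_range.2 hj)).mul_left d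
    refine Nat.Coprime.coprime_dvd_left h1 ?_
    rw [hM]
    simp
  set e : ℕ → EuclideanSpace ℝ (Fin d) :=
    fun j ↦ if h : j < d then EuclideanSpace.single ⟨j, h⟩ 1 else 0 with he
  have hetop : Submodule.span ℝ (e '' Set.Iio d) = ⊤ := by
    rw [eq_top_iff, ← (EuclideanSpace.basisFun (Fin d) ℝ).toBasis.span_eq]
    refine Submodule.span_mono ?_
    rintro _ ⟨j, rfl⟩
    exact ⟨j, j.2, by simp [he]⟩
  obtain ⟨Q, hQε, -, hQ⟩ := exists_perturbation (latticeBox d n) p n hε e d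
  refine ⟨Q, hQε, fun A hA hcard ↦ ?_⟩
  -- With `k = 0` the initial congruence is vacuous, so this selects one class modulo `M`.
  obtain ⟨A', hA'A, hA'card, hA'M⟩ := exists_congruent_subset (p := M) (k := 0) (by omega)
    (hcard ▸ hℓ) (by intro x _ y _ i; simp)
  rw [zero_add, pow_one] at hA'M
  obtain ⟨C, hCA, B, hBC, hB2, t, m, ht, hspan, hBm, hadm⟩ := exists_chain_vectorSpan_eq
    (K := n) (fun i ↦ (hp i).pos) d d (C := A')
    ((Submodule.finrank_le _).trans (by simp)) hA'card
    fun j x hx y hy h ↦ eq_of_latticeCong_pow (hp j).one_lt (hA (hA'A hx)) (hA (hA'A hy)) h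
  obtain ⟨y, hyt, hy⟩ := exists_core_latticePoint hdM (i := d) (q := fun j ↦ p j ^ m j)
    (fun j _ k _ hjk ↦ Nat.Coprime.pow _ _
      ((Nat.coprime_primes (hp j) (hp k)).2 fun h ↦ hjk (hinj h)))
    (fun j hj ↦ (hpM j hj).pow_left _) (Finset.card_pos.1 (by omega)) hBC hspan
    (fun x hx y hy ↦ hA'M x (hCA (hBC hx)) y (hCA (hBC hy))) hBm ht
  have hCX : C ⊆ latticeBox d n := hCA.trans (hA'A.trans hA)
  have hybox : y ∈ latticeBox d n := mem_latticeBox_of_mem_convexHull (hBC.trans hCX) hy.mem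
  have hcore := hQ C hCX y hybox (hadm y hyt hy)
  rw [hetop, sup_top_eq] at hcore
  exact ⟨y, hybox, interior_mono (convexHull_mono (Set.image_mono
    (by exact_mod_cast hCA.trans hA'A))) (hcore.mem_interior (convex_convexHull ℝ _))⟩

theorem exists_isPerturbation_isHoleFree {n ℓ : ℕ} {ε : ℝ} (hε : 0 < ε)
    (h : ∀ δ : ℝ, 0 < δ → ∃ Q : (Fin d → ℤ) → EuclideanSpace ℝ (Fin d),
      (∀ x ∈ latticeBox d n, ‖Q x - latticePoint x‖ < δ) ∧
      ∀ A ⊆ latticeBox d n, A.card = ℓ → ∃ y ∈ latticeBox d n,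
        Q y ∈ interior (convexHull ℝ (Q '' (A : Set (Fin d → ℤ))))) :
    ∃ (P : EuclideanSpace ℝ (Fin d) → EuclideanSpace ℝ (Fin d))
      (B : Set (EuclideanSpace ℝ (Fin d))),
      IsPerturbation ε P (latticeCube d n) B ∧ IsHoleFree ℓ B := by
  classical
  -- Moves shorter than `1 / 2` cannot make two lattice points coincide.
  obtain ⟨Q, hQ, hhole⟩ := h (min ε (1 / 2)) (by positivity)
  have hinj : Set.InjOn Q (latticeBox d n : Set (Fin d → ℤ)) := by
    intro x hx y hy hxy
    have h1 : ‖latticePoint x - latticePoint y‖ < 1 := by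
      have e1 : latticePoint x - latticePoint y =
          (Q y - latticePoint y) - (Q x - latticePoint x) := by rw [hxy]; abel
      rw [e1]
      have h2 := (hQ x hx).trans_le (min_le_right _ _)
      have h3 := (hQ y hy).trans_le (min_le_right _ _)
      linarith [norm_sub_le (Q y - latticePoint y) (Q x - latticePoint x)]
    funext i
    have h2 := (PiLp.norm_apply_le (latticePoint x - latticePoint y) i).trans_lt h1
    have h3 : |((x i - y i : ℤ) : ℝ)| < 1 := by simpa using h2
    have h4 : |x i - y i| < 1 := by exact_mod_cast h3
    have := Int.abs_lt_one_iff.1 h4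
    omega
  have hfloor : ∀ x : Fin d → ℤ, (fun i ↦ ⌊latticePoint x i⌋) = x := fun x ↦ by simp
  have hcube : ∀ z ∈ latticeCube d n, ∃ x ∈ latticeBox d n, latticePoint x = z := by
    intro z hz
    choose m hm hz using hz
    refine ⟨fun i ↦ (m i : ℤ), mem_latticeBox.2 fun i ↦ ?_, ?_⟩
    · have := Finset.mem_Icc.1 (hm i)
      exact_mod_cast this
    · ext i; simp [hz i]
  have hbox : ∀ x ∈ latticeBox d n, latticePoint x ∈ latticeCube d n := by
    intro x hx i
    have := mem_latticeBox.1 hx i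
    obtain ⟨m, hm⟩ := Int.eq_ofNat_of_zero_le (show 0 ≤ x i by omega)
    refine ⟨m, Finset.mem_Icc.2 (by omega), ?_⟩
    simp [hm]
  have himage : (fun z ↦ Q fun i ↦ ⌊z i⌋) '' latticeCube d n =
      Q '' (latticeBox d n : Set (Fin d → ℤ)) := by
    ext z
    constructor
    · rintro ⟨z, hz, rfl⟩
      obtain ⟨x, hx, rfl⟩ := hcube z hz
      exact ⟨x, hx, by simp⟩
    · rintro ⟨x, hx, rfl⟩
      exact ⟨latticePoint x, hbox x hx, by simp⟩
  refine ⟨fun z ↦ Q fun i ↦ ⌊z i⌋, _, ⟨Set.InjOn.bijOn_image ?_, ?_⟩, ?_⟩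
  · intro z hz z' hz' hzz'
    obtain ⟨x, hx, rfl⟩ := hcube z hz
    obtain ⟨y, hy, rfl⟩ := hcube z' hz'
    simp only [hfloor] at hzz'
    rw [hinj hx hy hzz']
  · intro z hz
    obtain ⟨x, hx, rfl⟩ := hcube z hz
    simp only [hfloor]
    rw [norm_sub_rev]
    exact (hQ x hx).trans_le (min_le_left _ _)
  · rw [himage]
    intro A hA hcard
    set A' := (latticeBox d n).filter fun x ↦ Q x ∈ A with hA'
    have h1 : Q '' (A' : Set (Fin d → ℤ)) = A := by
      ext z
      constructor
      · rintro ⟨x, hx, rfl⟩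
        exact (Finset.mem_filter.1 hx).2
      · intro hz
        obtain ⟨x, hx, rfl⟩ := hA hz
        exact ⟨x, Finset.mem_filter.2 ⟨hx, hz⟩, rfl⟩
    have h2 : A'.card = ℓ := by
      rw [← hcard, ← Finset.card_image_of_injOn (f := Q) (s := A')]
      · congr 1
        rw [← Finset.coe_inj, Finset.coe_image, h1]
      · exact hinj.mono fun x hx ↦ (Finset.mem_filter.1 hx).1
    obtain ⟨y, hy, hint⟩ := hhole A' (Finset.filter_subset _ _) h2
    rw [h1] at hint
    exact ⟨Q y, ⟨y, hy, rfl⟩, hint⟩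

end Perturbation

/-! ### Size of the constant. -/

theorem lcmUpto_le_pow_primeCounting (n : ℕ) : Nat.lcmUpto n ≤ n ^ Nat.primeCounting n := by
  rcases Nat.eq_zero_or_pos n with rfl | hn
  · simp [Nat.lcmUpto]
  rw [Nat.lcmUpto_eq_prod_pow_log]
  refine (Finset.prod_le_pow_card _ _ n fun p _ ↦ Nat.pow_log_le_self p hn.ne').trans ?_
  rw [Nat.primesLE_card_eq_primeCounting]

/-- Combine `2 ^ N ≤ (N + 1) * lcm(1, …, N)` with `lcm(1, …, N) ≤ N ^ π(N)` for `N = d ^ 5`. Fewer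
than `d` primes up to `N` would give `2 ^ (d ^ 5) ≤ d ^ (5 * d + 1) < 2 ^ (d * (5 * d + 1))`, which
is too small. -/
theorem nth_prime_le_pow {d j : ℕ} (hd : 2 ≤ d) (hj : j < d) : Nat.nth Nat.Prime j ≤ d ^ 5 := by
  refine Nat.lt_succ_iff.1 (Nat.nth_lt_of_lt_count ?_)
  change j < Nat.primeCounting (d ^ 5)
  by_contra! h
  have h1 := (Chebyshev.two_pow_le_mul_lcmUpto (d ^ 5)).trans
    (Nat.mul_le_mul_left _ (lcmUpto_le_pow_primeCounting (d ^ 5)))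
  have h2 : (d ^ 5) ^ Nat.primeCounting (d ^ 5) ≤ d ^ (5 * (d - 1)) := by
    rw [← pow_mul]; exact Nat.pow_le_pow_right (by omega) (by omega)
  have h3 : d ^ 5 + 1 ≤ d ^ 6 := by
    have : 0 < d ^ 5 := by positivity
    rw [pow_succ d 5]; nlinarith
  have h4 : 2 ^ (d ^ 5) ≤ d ^ (5 * d + 1) := by
    refine h1.trans ((Nat.mul_le_mul h3 h2).trans ?_)
    rw [← pow_add]; exact Nat.pow_le_pow_right (by omega) (by omega)
  have h5 : d ^ (5 * d + 1) < (2 ^ d) ^ (5 * d + 1) :=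
    Nat.pow_lt_pow_left Nat.lt_two_pow_self (by omega)
  rw [← pow_mul] at h5
  have h6 := (Nat.pow_lt_pow_iff_right (by norm_num)).1 (h4.trans_lt h5)
  have h7 : d * (5 * d + 1) ≤ d ^ 5 := by
    have : 5 * d + 1 ≤ d ^ 4 := by
      have a1 : 4 ≤ d ^ 2 := by nlinarith
      have : d ^ 4 = d ^ 2 * d ^ 2 := by ring
      nlinarith
    calc d * (5 * d + 1) ≤ d * d ^ 4 := Nat.mul_le_mul_left d this
      _ = d ^ 5 := by ring
  omega

theorem holeFree_bound {d : ℕ} (hd : 2 ≤ d) {p : ℕ → ℕ} (hp : ∀ j < d, p j ≤ d ^ 5) :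
    2 * (∏ j ∈ Finset.range d, p j ^ (2 * d)) ^ (d + 1) *
      (d * ∏ j ∈ Finset.range d, p j + 1) ^ d ≤ d ^ (40 * d ^ 3) := by
  have h1 : ∏ j ∈ Finset.range d, p j ≤ d ^ (5 * d) := by
    refine (Finset.prod_le_pow_card _ _ (d ^ 5) fun j hj ↦ hp j (Finset.mem_range.1 hj)).trans ?_
    rw [Finset.card_range, ← pow_mul]
  have h2 : ∏ j ∈ Finset.range d, p j ^ (2 * d) ≤ d ^ (5 * d * (2 * d)) := by
    rw [Finset.prod_pow, pow_mul d (5 * d)]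
    exact Nat.pow_le_pow_left h1 _
  have h3 : d * ∏ j ∈ Finset.range d, p j + 1 ≤ d ^ (5 * d + 2) := by
    have : 0 < d ^ (5 * d) := by positivity
    have e : d ^ (5 * d + 2) = d * (d * d ^ (5 * d)) := by ring
    have : d * ∏ j ∈ Finset.range d, p j ≤ d * d ^ (5 * d) := Nat.mul_le_mul_left d h1
    have : 1 ≤ d * d ^ (5 * d) := Nat.mul_pos (by omega) (by omega)
    rw [e]; nlinarith
  calc 2 * (∏ j ∈ Finset.range d, p j ^ (2 * d)) ^ (d + 1) *
      (d * ∏ j ∈ Finset.range d, p j + 1) ^ d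
      ≤ d * (d ^ (5 * d * (2 * d))) ^ (d + 1) * (d ^ (5 * d + 2)) ^ d := by gcongr
    _ = d ^ (1 + 5 * d * (2 * d) * (d + 1) + (5 * d + 2) * d) := by
      rw [← pow_mul, ← pow_mul, pow_add _ _ ((5 * d + 2) * d), pow_add _ 1, pow_one]
    _ ≤ d ^ (40 * d ^ 3) := by
      refine Nat.pow_le_pow_right (by omega) ?_
      have a1 : d ^ 2 ≤ d ^ 3 := Nat.pow_le_pow_right (by omega) (by norm_num)
      have a2 : d ≤ d ^ 3 := Nat.le_self_pow (by norm_num) d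
      nlinarith

/-! ### Seven lattice points in the plane. -/

/-- If a point dominates the three vertices of a triangle that contains it in its interior, under a
linear functional, then this functional vanishes. -/
theorem eq_zero_of_triangle {j s t x : ℤ} (hj : 1 ≤ j) (h1 : s < t * x)
    (h2 : t * x < s + 2 * j * (t - 1)) {α β : ℝ} (H0 : 0 ≤ α * x + β) (H1 : α * (2 * j) ≤ α * x + β)
    (H2 : α * s + β * t ≤ α * x + β) : α = 0 ∧ β = 0 := by
  have h1' : (s : ℝ) < t * x := by exact_mod_cast h1
  have h2' : (t * x : ℝ) < s + 2 * j * (t - 1) := by exact_mod_cast h2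
  have hj' : (1 : ℝ) ≤ j := by exact_mod_cast hj
  -- The three factors are the barycentric coordinates of `(x, 1)` in the triangle `(0, 0)`, `(2 *
  -- j, 0)`, `(s, t)`, scaled by `2 * j * t`.
  have key : 2 * j * ((α * x + β) - (α * s + β * t)) + (t * x - s) * ((α * x + β) - α * (2 * j))
      + (s + 2 * j * (t - 1) - t * x) * (α * x + β) = 0 := by ring
  have p1 : 0 ≤ 2 * j * ((α * x + β) - (α * s + β * t)) :=
    mul_nonneg (by linarith) (by linarith)
  have p2 : 0 ≤ (t * x - s) * ((α * x + β) - α * (2 * j)) :=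
    mul_nonneg (by linarith) (by linarith)
  have p3 : 0 ≤ (s + 2 * j * (t - 1) - t * x) * (α * x + β) :=
    mul_nonneg (by linarith) (by linarith)
  have q3 : (s + 2 * j * (t - 1) - t * x) * (α * x + β) = 0 := by linarith
  have q2 : (t * x - s) * ((α * x + β) - α * (2 * j)) = 0 := by linarith
  have r3 : α * x + β = 0 := by
    rcases mul_eq_zero.1 q3 with h | h
    · linarith
    · exact h
  have r2 : α = 0 := by
    rcases mul_eq_zero.1 q2 with h | h
    · linarith
    · rw [r3] at h
      have : α * (2 * j) = 0 := by linarith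
      rcases mul_eq_zero.1 this with h | h
      · exact h
      · linarith
  exact ⟨r2, by rw [r2] at r3; linarith⟩

/-- Seven lattice points in a closed half-plane, two of them `(0, 0)` and `(2 * j, 0)` on its
boundary, have an interior lattice point or four of them on one of the first two lines. -/
theorem exists_interior_or_four_on_line_of_halfPlane {T : Finset (ℤ × ℤ)} (hT : T.card = 7) {j : ℤ}
    (hj : 1 ≤ j) (h0 : ((0 : ℤ), (0 : ℤ)) ∈ T) (h1 : (2 * j, (0 : ℤ)) ∈ T)
    (hpos : ∀ q ∈ T, 0 ≤ q.2) :
    (∃ x : ℤ, ∀ α β : ℝ, (∀ q ∈ T, α * q.1 + β * q.2 ≤ α * x + β) → α = 0 ∧ β = 0) ∨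
      4 ≤ (T.filter fun q ↦ q.2 = 0).card ∨ 4 ≤ (T.filter fun q ↦ q.2 = 1).card := by
  by_contra! hcon
  obtain ⟨hint, hT0, hT1⟩ := hcon
  have hno : ∀ x : ℤ, ¬ ∀ α β : ℝ, (∀ q ∈ T, α * q.1 + β * q.2 ≤ α * x + β) → α = 0 ∧ β = 0 := by
    intro x hx
    obtain ⟨α, β, h, h'⟩ := hint x
    exact h' (hx α β h).1 (hx α β h).2
  have H0 : ∀ {α β : ℝ} {x : ℤ}, (∀ q ∈ T, α * q.1 + β * q.2 ≤ α * x + β) → 0 ≤ α * x + β :=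
    fun h ↦ by simpa using h _ h0
  have H1 : ∀ {α β : ℝ} {x : ℤ}, (∀ q ∈ T, α * q.1 + β * q.2 ≤ α * x + β) →
      α * (2 * j) ≤ α * x + β :=
    fun h ↦ by simpa using h _ h1
  have hbig : ∀ q ∈ T, 2 ≤ q.2 → q.2 = 2 ∧ j = 1 ∧ ∃ u, q.1 = 2 * u := by
    rintro ⟨s, t⟩ hq ht
    dsimp only at ht ⊢
    have hd := Int.mul_ediv_add_emod s t
    have hm0 := Int.emod_nonneg s (show t ≠ 0 by omega)
    have hm1 := Int.emod_lt_of_pos s (show 0 < t by omega)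
    have hx1 : s < t * (s / t + 1) := by rw [mul_add]; omega
    -- The triangle meets the line of height `1` in a segment starting at `s / t`, of length `2 * j
    -- * (t - 1) / t`. If it has no integer strictly inside, this length is at most `1`.
    have hx2 : s + 2 * j * (t - 1) ≤ t * (s / t + 1) := by
      by_contra! h
      exact hno (s / t + 1) fun α β hαβ ↦
        eq_zero_of_triangle hj hx1 h (H0 hαβ) (H1 hαβ) (hαβ _ hq)
    have hx3 : 2 * j * (t - 1) ≤ t := by rw [mul_add] at hx2; linarith
    have ht2 : t = 2 := by nlinarith
    subst ht2
    exact ⟨rfl, by omega, s / 2, by omega⟩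
  have hpart : ∀ q ∈ T, q.2 = 0 ∨ q.2 = 1 ∨ 2 ≤ q.2 := fun q hq ↦ by
    have := hpos q hq; omega
  have hsplit : T ⊆ (T.filter fun q ↦ q.2 = 0) ∪ (T.filter fun q ↦ q.2 = 1) ∪
      (T.filter fun q ↦ 2 ≤ q.2) := fun q hq ↦ by
    have := hpart q hq
    simp only [Finset.mem_union, Finset.mem_filter]
    tauto
  have hcard : 7 ≤ (T.filter fun q ↦ q.2 = 0).card + (T.filter fun q ↦ q.2 = 1).card +
      (T.filter fun q ↦ 2 ≤ q.2).card := by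
    rw [← hT]
    exact (Finset.card_le_card hsplit).trans ((Finset.card_union_le _ _).trans
      (Nat.add_le_add_right (Finset.card_union_le _ _) _))
  have hone : (T.filter fun q ↦ 2 ≤ q.2).card ≤ 1 := by
    have key : ∀ q ∈ T, 2 ≤ q.2 → ∀ q' ∈ T, 2 ≤ q'.2 → ¬ q.1 < q'.1 := by
      rintro ⟨s, t⟩ hq ht ⟨s', t'⟩ hq' ht' hlt
      obtain ⟨rfl, rfl, u, hu⟩ := hbig _ hq ht
      obtain ⟨h2, -, u', hu'⟩ := hbig _ hq' ht'
      dsimp only at hu hu' hlt h2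
      subst hu hu' h2
      refine hno (u + 1) fun α β hαβ ↦ ?_
      have a0 := H0 hαβ
      have a1 := H1 hαβ
      have a2 := hαβ _ hq
      have a3 := hαβ _ hq'
      push_cast at a0 a1 a2 a3
      have hu : (1 : ℝ) ≤ u' - u := by
        have : 1 ≤ u' - u := by omega
        exact_mod_cast this
      have b1 : α = α * u + β := by linarith
      have b2 : 0 ≤ α := by linarith
      have b3 : α * (u' - u) ≤ 0 := by linarith
      have b4 : α = 0 := by nlinarith
      subst b4
      exact ⟨rfl, by linarith⟩
    refine Finset.card_le_one.2 fun q hq q' hq' ↦ ?_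
    rw [Finset.mem_filter] at hq hq'
    refine Prod.ext (le_antisymm (not_lt.1 (key q' hq'.1 hq'.2 q hq.1 hq.2))
      (not_lt.1 (key q hq.1 hq.2 q' hq'.1 hq'.2))) ?_
    rw [(hbig q hq.1 hq.2).1, (hbig q' hq'.1 hq'.2).1]
  obtain ⟨⟨s, t⟩, hq⟩ : (T.filter fun q ↦ 2 ≤ q.2).Nonempty := Finset.card_pos.1 (by omega)
  rw [Finset.mem_filter] at hq
  obtain ⟨rfl, rfl, u, hu⟩ := hbig _ hq.1 hq.2
  dsimp only at hu
  subst hu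
  -- With apex `(2 * u, 2)` and `j = 1`, the triangle cuts height `1` exactly in `[u, u + 1]`; a
  -- point outside would make one endpoint interior. So the three rows hold at most `3 + 2 + 1 = 6`
  -- points.
  have hT1' : (T.filter fun q ↦ q.2 = 1) ⊆ {(u, 1), (u + 1, 1)} := by
    rintro ⟨x, t⟩ hx
    rw [Finset.mem_filter] at hx
    obtain ⟨hx, rfl⟩ := hx
    have hge : u ≤ x := by
      by_contra! hlt
      refine hno u fun α β hαβ ↦ ?_
      have a0 := H0 hαβ
      have a1 := H1 hαβ
      have a2 := hαβ _ hq.1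
      have a3 := hαβ _ hx
      push_cast at a0 a1 a2 a3
      have hu : (1 : ℝ) ≤ u - x := by
        have : 1 ≤ u - x := by omega
        exact_mod_cast this
      have b1 : α * u + β = 0 := by linarith
      have b2 : α ≤ 0 := by linarith
      have b3 : 0 ≤ α * (u - x) := by linarith
      have b4 : α = 0 := by nlinarith
      subst b4
      exact ⟨rfl, by linarith⟩
    have hle : x ≤ u + 1 := by
      by_contra! hlt
      refine hno (u + 1) fun α β hαβ ↦ ?_
      have a0 := H0 hαβ
      have a1 := H1 hαβ
      have a2 := hαβ _ hq.1
      have a3 := hαβ _ hx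
      push_cast at a0 a1 a2 a3
      have hu : (1 : ℝ) ≤ x - u - 1 := by
        have : 1 ≤ x - u - 1 := by omega
        exact_mod_cast this
      have b1 : α = α * u + β := by linarith
      have b2 : 0 ≤ α := by linarith
      have b3 : α * (x - u - 1) ≤ 0 := by linarith
      have b4 : α = 0 := by nlinarith
      subst b4
      exact ⟨rfl, by linarith⟩
    have : x = u ∨ x = u + 1 := by omega
    rcases this with rfl | rfl <;> simp
  have := (Finset.card_le_card hT1').trans Finset.card_le_two
  omega

theorem exists_interior_or_four_on_line {A : Finset (Fin 2 → ℤ)} (hA : A.card = 7) :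
    (∃ z : Fin 2 → ℤ, ∀ α β : ℝ, (∀ a ∈ A, α * a 0 + β * a 1 ≤ α * z 0 + β * z 1) →
      α = 0 ∧ β = 0) ∨
    ∃ v : Fin 2 → ℤ, IsCoprime (v 0) (v 1) ∧ ∃ t : ℤ,
      4 ≤ (A.filter fun x ↦ v 0 * x 1 - v 1 * x 0 = t).card := by
  classical
  -- Seven points share four parity classes, so two of them have a lattice midpoint, and `c - a = 2
  -- * j * v` with `v` primitive.
  obtain ⟨a, ha, c, hc, hac, hcong⟩ := Finset.exists_ne_map_eq_of_card_lt_of_maps_to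
    (s := A) (t := (Finset.univ : Finset (Fin 2 → ZMod 2))) (f := fun x i ↦ (x i : ZMod 2))
    (by rw [hA]; simp [ZMod.card]) (fun _ _ ↦ Finset.mem_univ _)
  have hu : ∀ i, ∃ u : ℤ, c i - a i = 2 * u := fun i ↦ by
    have h := congrFun hcong i
    exact (ZMod.intCast_eq_intCast_iff_dvd_sub _ _ 2).1 h
  choose u hu using hu
  have hg : 0 < Int.gcd (u 0) (u 1) := by
    rw [Nat.pos_iff_ne_zero]
    intro h
    rw [Int.gcd_eq_zero_iff] at h
    refine hac (funext fun i ↦ ?_)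
    have := hu i
    fin_cases i <;> simp_all <;> omega
  obtain ⟨j, hj⟩ : ∃ j : ℤ, j = (Int.gcd (u 0) (u 1) : ℕ) := ⟨_, rfl⟩
  obtain ⟨v₀, hv₀⟩ : j ∣ u 0 := hj ▸ Int.gcd_dvd_left ..
  obtain ⟨v₁, hv₁⟩ : j ∣ u 1 := hj ▸ Int.gcd_dvd_right ..
  have hj1 : 1 ≤ j := by rw [hj]; exact_mod_cast hg
  obtain ⟨p, q, hpq⟩ : ∃ p q : ℤ, p * v₀ + q * v₁ = 1 := by
    refine ⟨Int.gcdA (u 0) (u 1), Int.gcdB (u 0) (u 1), ?_⟩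
    have := Int.gcd_eq_gcd_ab (u 0) (u 1)
    rw [← hj] at this
    refine mul_left_cancel₀ (show j ≠ 0 by omega) ?_
    linear_combination (-Int.gcdA (u 0) (u 1)) * hv₀ - Int.gcdB (u 0) (u 1) * hv₁ - this
  by_contra! hcon
  obtain ⟨hint, hline⟩ := hcon
  have hno : ∀ z : Fin 2 → ℤ, ¬ ∀ α β : ℝ,
      (∀ a ∈ A, α * a 0 + β * a 1 ≤ α * z 0 + β * z 1) → α = 0 ∧ β = 0 := by
    intro z hz
    obtain ⟨α, β, h, h'⟩ := hint z
    exact h' (hz α β h).1 (hz α β h).2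
  have hline : ∀ t : ℤ, (A.filter fun x ↦ v₀ * x 1 - v₁ * x 0 = t).card < 4 := fun t ↦ by
    have := hline ![v₀, v₁] ⟨p, q, by simpa using hpq⟩ t
    simpa using this
  -- coordinates `(s, t)` with respect to the basis `(v₀, v₁)`, `(-q, p)`
  have hpqR : (p : ℝ) * v₀ + q * v₁ = 1 := by exact_mod_cast hpq
  set s : (Fin 2 → ℤ) → ℤ := fun x ↦ p * (x 0 - a 0) + q * (x 1 - a 1) with hs
  set t : (Fin 2 → ℤ) → ℤ := fun x ↦ v₀ * (x 1 - a 1) - v₁ * (x 0 - a 0) with ht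
  have hx0 : ∀ x : Fin 2 → ℤ, x 0 = a 0 + s x * v₀ - t x * q := fun x ↦ by
    simp only [hs, ht]; linear_combination (-(x 0 - a 0)) * hpq
  have hx1 : ∀ x : Fin 2 → ℤ, x 1 = a 1 + s x * v₁ + t x * p := fun x ↦ by
    simp only [hs, ht]; linear_combination (-(x 1 - a 1)) * hpq
  have hsa : s a = 0 := by simp [hs]
  have hta : t a = 0 := by simp [ht]
  have hc0 : c 0 - a 0 = 2 * j * v₀ := by rw [hu, hv₀]; ring
  have hc1 : c 1 - a 1 = 2 * j * v₁ := by rw [hu, hv₁]; ring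
  have hsc : s c = 2 * j := by
    simp only [hs]; rw [hc0, hc1]; linear_combination (2 * j) * hpq
  have htc : t c = 0 := by simp only [ht]; rw [hc0, hc1]; ring
  -- The sign `σ` reflects either closed side of the line `ac` onto the upper half-plane.
  have hside : ∀ σ : ℤ, σ = 1 ∨ σ = -1 → ¬ ∀ x ∈ A, 0 ≤ σ * t x := by
    intro σ hσ hpos
    have hσ2 : σ * σ = 1 := by rcases hσ with rfl | rfl <;> norm_num
    have hσ2R : (σ : ℝ) * σ = 1 := by exact_mod_cast hσ2
    have hinj : Function.Injective fun x ↦ (s x, σ * t x) := by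
      intro x y hxy
      rw [Prod.mk.injEq] at hxy
      have h2 : t x = t y := by
        have := congrArg (σ * ·) hxy.2
        simpa only [← mul_assoc, hσ2, one_mul] using this
      funext i
      fin_cases i
      · simp only [Fin.zero_eta]; rw [hx0 x, hx0 y, hxy.1, h2]
      · simp only [Fin.mk_one]; rw [hx1 x, hx1 y, hxy.1, h2]
    have hfil : ∀ b : ℤ, ((A.image fun x ↦ (s x, σ * t x)).filter fun q ↦ q.2 = b).card < 4 := by
      intro b
      rw [Finset.filter_image, Finset.card_image_of_injective _ hinj]
      refine (Finset.card_le_card ?_).trans_lt (hline (σ * b + v₀ * a 1 - v₁ * a 0))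
      intro x hx
      rw [Finset.mem_filter] at hx ⊢
      refine ⟨hx.1, ?_⟩
      have : t x = σ * b := by rw [← hx.2, ← mul_assoc, hσ2, one_mul]
      rw [← this]; simp only [ht]; ring
    rcases exists_interior_or_four_on_line_of_halfPlane
      (T := A.image fun x ↦ (s x, σ * t x)) (by rw [Finset.card_image_of_injective _ hinj, hA]) hj1
      (Finset.mem_image.2 ⟨a, ha, by simp [hsa, hta]⟩)
      (Finset.mem_image.2 ⟨c, hc, by simp [hsc, htc]⟩)
      (by simpa using hpos) with ⟨x, hx⟩ | h | h
    · refine hno ![a 0 + x * v₀ - σ * q, a 1 + x * v₁ + σ * p] fun α β hαβ ↦ ?_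
      have := hx (α * v₀ + β * v₁) (σ * (β * p - α * q)) ?_
      · obtain ⟨e1, e2⟩ := this
        have e3 : β * p - α * q = 0 := by
          have : (σ : ℝ) * (σ * (β * p - α * q)) = 0 := by rw [e2, mul_zero]
          rwa [← mul_assoc, hσ2R, one_mul] at this
        constructor
        · linear_combination (-α) * hpqR + p * e1 - v₁ * e3
        · linear_combination (-β) * hpqR + q * e1 + v₀ * e3
      · intro q' hq'
        obtain ⟨y, hy, rfl⟩ := Finset.mem_image.1 hq'
        have h1 := hαβ y hy
        have h2 : (y 0 : ℝ) = a 0 + s y * v₀ - t y * q := by exact_mod_cast hx0 y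
        have h3 : (y 1 : ℝ) = a 1 + s y * v₁ + t y * p := by exact_mod_cast hx1 y
        rw [h2, h3] at h1
        simp at h1 ⊢
        linear_combination h1 + (β * p - α * q) * t y * hσ2R
    · exact absurd h (not_le.2 (hfil 0))
    · exact absurd h (not_le.2 (hfil 1))
  have hneg := hside 1 (Or.inl rfl)
  have hpos := hside (-1) (Or.inr rfl)
  push Not at hneg hpos
  obtain ⟨x, hx, hxt⟩ := hneg
  obtain ⟨y, hy, hyt⟩ := hpos
  -- Points of `A` lie strictly on both sides of the line `ac`, so the midpoint of `a` and `c` is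
  -- interior.
  refine hno ![a 0 + j * v₀, a 1 + j * v₁] fun α β hαβ ↦ ?_
  have hjR : (1 : ℝ) ≤ j := by exact_mod_cast hj1
  have h1 := hαβ a ha
  have h2 := hαβ c hc
  have hc0R : (c 0 : ℝ) - a 0 = 2 * j * v₀ := by exact_mod_cast hc0
  have hc1R : (c 1 : ℝ) - a 1 = 2 * j * v₁ := by exact_mod_cast hc1
  have e2 : (c 0 : ℝ) = a 0 + 2 * j * v₀ := by linarith
  have e3 : (c 1 : ℝ) = a 1 + 2 * j * v₁ := by linarith
  rw [e2, e3] at h2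
  simp at h1 h2
  have e1 : α * v₀ + β * v₁ = 0 := by
    have : j * (α * v₀ + β * v₁) = 0 := by nlinarith
    rcases mul_eq_zero.1 this with h | h
    · linarith
    · exact h
  have hval : ∀ y ∈ A, (β * p - α * q) * t y ≤ 0 := fun y hy ↦ by
    have h1 := hαβ y hy
    have h2 : (y 0 : ℝ) = a 0 + s y * v₀ - t y * q := by exact_mod_cast hx0 y
    have h3 : (y 1 : ℝ) = a 1 + s y * v₁ + t y * p := by exact_mod_cast hx1 y
    rw [h2, h3] at h1
    simp at h1
    linear_combination h1 + (j - s y) * e1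
  have hxR : (t x : ℝ) < 0 := by
    have : t x < 0 := by linarith
    exact_mod_cast this
  have hyR : (0 : ℝ) < t y := by
    have : 0 < t y := by linarith
    exact_mod_cast this
  have e4 : β * p - α * q = 0 := by
    have := hval x hx
    have := hval y hy
    nlinarith
  constructor
  · linear_combination (-α) * hpqR + p * e1 - v₁ * e4
  · linear_combination (-β) * hpqR + q * e1 + v₀ * e4

/-! ### Interior points detected by linear functionals. -/

section Functional

/-- If `S` spans no full-dimensional hull, some `f ≠ 0` is constant on `S`, and `f` or `-f` violates
the hypothesis. Otherwise a functional separating `z` from the interior does. -/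
theorem mem_interior_convexHull_of_forall_functional {E : Type*} [NormedAddCommGroup E]
    [NormedSpace ℝ E] [FiniteDimensional ℝ E] {S : Set E} (hS : S.Nonempty) {z : E}
    (h : ∀ f : E →ₗ[ℝ] ℝ, (∀ a ∈ S, f a ≤ f z) → f = 0) : z ∈ interior (convexHull ℝ S) := by
  obtain ⟨a₀, ha₀⟩ := hS
  have hne : (interior (convexHull ℝ S)).Nonempty := by
    rw [(convex_convexHull ℝ S).interior_nonempty_iff_affineSpan_eq_top, affineSpan_convexHull,
      AffineSubspace.affineSpan_eq_top_iff_vectorSpan_eq_top_of_nonempty ℝ E E ⟨a₀, ha₀⟩]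
    by_contra hV
    obtain ⟨f, hf0, hf⟩ := Submodule.exists_le_ker_of_lt_top _ (lt_top_iff_ne_top.2 hV)
    have hconst : ∀ a ∈ S, f a = f a₀ := fun a ha ↦ by
      have := LinearMap.mem_ker.1 (hf (vsub_mem_vectorSpan ℝ ha ha₀))
      rwa [vsub_eq_sub, map_sub, sub_eq_zero] at this
    rcases le_total (f a₀) (f z) with hle | hle
    · exact hf0 (h f fun a ha ↦ by rw [hconst a ha]; exact hle)
    · refine hf0 (neg_eq_zero.1 (h (-f) fun a ha ↦ ?_))
      simpa [hconst a ha] using hle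
  by_contra hz
  obtain ⟨f, hf⟩ := geometric_hahn_banach_open_point (convex_convexHull ℝ S).interior
    isOpen_interior hz
  have hle : ∀ a ∈ S, f a ≤ f z := fun a ha ↦ by
    have hcl : a ∈ closure (interior (convexHull ℝ S)) := by
      rw [(convex_convexHull ℝ S).closure_interior_eq_closure_of_nonempty_interior hne]
      exact subset_closure (subset_convexHull ℝ S ha)
    exact closure_minimal (fun b hb ↦ (hf b hb).le) (isClosed_Iic.preimage f.continuous) hcl
  have hf0 : ∀ b, f b = 0 := fun b ↦ by
    have := h f.toLinearMap hle
    exact LinearMap.congr_fun this b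
  obtain ⟨b, hb⟩ := hne
  have := hf b hb
  rw [hf0, hf0] at this
  exact lt_irrefl _ this

end Functional

/-! ### Binary digits of integers on a lattice line. -/

section Line

variable {d : ℕ}

theorem two_pow_succ_dvd_or {k : ℕ} {a b m : ℤ} (hab : (2 : ℤ) ^ k ∣ a - b)
    (hab' : ¬ (2 : ℤ) ^ (k + 1) ∣ a - b) (hm : (2 : ℤ) ^ k ∣ m - a) :
    (2 : ℤ) ^ (k + 1) ∣ m - a ∨ (2 : ℤ) ^ (k + 1) ∣ m - b := by
  obtain ⟨u, hu⟩ := hab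
  obtain ⟨w, hw⟩ := hm
  rcases Int.even_or_odd' w with ⟨w', rfl | rfl⟩
  · left; exact ⟨w', by rw [hw]; ring⟩
  · right
    rcases Int.even_or_odd' u with ⟨u', rfl | rfl⟩
    · exact absurd ⟨u', by rw [hu]; ring⟩ hab'
    · exact ⟨w' + u' + 1, by
        have : m - b = (m - a) + (a - b) := by ring
        rw [this, hw, hu]; ring⟩

/-- At the first binary digit that varies on `S` there are just two classes, low and high for the
sign `s`. Two high points have a low integer between them. Otherwise at least three points are low,
two of them on the same side of a high one, and the nearer of these two is `y`. The last clause
keeps `y` in the residue class of `S`, as `exists_between_digitAbove_both` requires. -/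
theorem exists_between_digitAbove {x : ℤ → Fin d → ℤ} (hinj : Function.Injective x)
    (hx : ∀ k m m', LatticeCong (2 ^ k) (x m) (x m') ↔ (2 : ℤ) ^ k ∣ m - m') {K : ℕ}
    {S : Finset ℤ} (hS : 4 ≤ S.card)
    (hK : ∀ m ∈ S, ∀ m' ∈ S, LatticeCong (2 ^ K) (x m) (x m') → x m = x m') {s : ℝ} (hs : s ≠ 0) :
    ∃ y, ∃ m₁ ∈ S, ∃ m₂ ∈ S, m₁ < y ∧ y < m₂ ∧
      DigitAbove 2 K s (S.image x) {x m₁, x m₂} (x y) ∧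
      ∀ k, (∀ m ∈ S, ∀ m' ∈ S, (2 : ℤ) ^ k ∣ m - m') → (2 : ℤ) ^ k ∣ y - m₁ := by
  obtain ⟨k, hkK, hk, hsplit⟩ := exists_first_split (p := 2) (K := K) (C := S.image x)
    (by rw [Finset.card_image_of_injective _ hinj]; omega) (by simpa using hK)
  simp only [Finset.forall_mem_image, Finset.exists_mem_image, hx] at hk hsplit
  set χ : ℤ → ℝ := fun m ↦ s * residueCode (2 ^ (k + 1)) (x m) with hχ
  have hχ_iff : ∀ m m', χ m = χ m' ↔ (2 : ℤ) ^ (k + 1) ∣ m - m' := fun m m' ↦ by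
    simp only [hχ]
    rw [mul_right_inj' hs, residueCode_eq_iff, hx]
  obtain ⟨a, ha, b, hb, hab⟩ : ∃ a ∈ S, ∃ b ∈ S, χ a < χ b := by
    obtain ⟨a, ha, b, hb, hab⟩ := hsplit
    rw [← hχ_iff] at hab
    rcases lt_or_gt_of_ne hab with h | h
    · exact ⟨a, ha, b, hb, h⟩
    · exact ⟨b, hb, a, ha, h⟩
  have hab' : ¬ (2 : ℤ) ^ (k + 1) ∣ a - b := by rw [← hχ_iff]; exact hab.ne
  have htwo : ∀ m, (2 : ℤ) ^ k ∣ m - a → χ m = χ a ∨ χ m = χ b := fun m hm ↦ by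
    rw [hχ_iff, hχ_iff]
    exact two_pow_succ_dvd_or (hk ha hb) hab' hm
  -- the digit condition, once the values of `χ` are known
  have hdigit : ∀ y m₁ m₂ c, m₁ ∈ S → m₂ ∈ S → c ∈ S → (2 : ℤ) ^ k ∣ y - a → χ y ≤ χ m₁ →
      χ y ≤ χ m₂ → χ y < χ c → DigitAbove 2 K s (S.image x) {x m₁, x m₂} (x y) := by
    intro y m₁ m₂ c h1 h2 hc hy hy1 hy2 hyc
    have hSy : ∀ m ∈ S, LatticeCong (2 ^ k) (x m) (x y) := fun m hm ↦ by
      rw [hx, show m - y = (m - a) - (y - a) by ring]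
      exact (hk hm ha).sub hy
    refine ⟨k, hkK, fun c' hc' ↦ ?_, x c, Finset.mem_image_of_mem x hc, hSy c hc, hyc⟩
    rw [Finset.mem_insert, Finset.mem_singleton] at hc'
    rcases hc' with rfl | rfl
    · exact ⟨hSy _ h1, hy1⟩
    · exact ⟨hSy _ h2, hy2⟩
  have hle : ∀ j, (∀ m ∈ S, ∀ m' ∈ S, (2 : ℤ) ^ j ∣ m - m') → j ≤ k := fun j hj ↦ by
    by_contra! hlt
    exact hab' ((pow_dvd_pow 2 (by omega)).trans (hj a ha b hb))
  have hcard : (S.filter fun m ↦ χ m = χ a).card + (S.filter fun m ↦ χ m = χ b).card = S.card := by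
    rw [← Finset.card_union_of_disjoint]
    · congr 1
      ext m
      simp only [Finset.mem_union, Finset.mem_filter]
      constructor
      · rintro (h | h) <;> exact h.1
      · intro hm
        rcases htwo m (hk hm ha) with h | h
        · exact Or.inl ⟨hm, h⟩
        · exact Or.inr ⟨hm, h⟩
    · refine Finset.disjoint_filter.2 fun m _ h h' ↦ hab.ne (h.symm.trans h')
  by_cases hb2 : 2 ≤ (S.filter fun m ↦ χ m = χ b).card
  · -- two high points: take a low point between them
    obtain ⟨m₁, hm₁, m₂, hm₂, hlt⟩ : ∃ m₁ ∈ S.filter fun m ↦ χ m = χ b,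
        ∃ m₂ ∈ S.filter fun m ↦ χ m = χ b, m₁ < m₂ := by
      obtain ⟨m₁, h1, m₂, h2, hne⟩ := Finset.one_lt_card.1 hb2
      rcases lt_or_gt_of_ne hne with h | h
      · exact ⟨m₁, h1, m₂, h2, h⟩
      · exact ⟨m₂, h2, m₁, h1, h⟩
    rw [Finset.mem_filter] at hm₁ hm₂
    have hpos : (0 : ℤ) < 2 ^ k := by positivity
    have hy : (2 : ℤ) ^ k ∣ m₁ + 2 ^ k - a := by
      rw [show m₁ + 2 ^ k - a = (m₁ - a) + 2 ^ k by ring]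
      exact (hk hm₁.1 ha).add dvd_rfl
    have hya : χ (m₁ + 2 ^ k) = χ a := by
      rcases htwo _ hy with h | h
      · exact h
      · rw [← hm₁.2, hχ_iff, add_sub_cancel_left, pow_succ] at h
        have := Int.le_of_dvd hpos h
        omega
    have hfar : (2 : ℤ) ^ (k + 1) ≤ m₂ - m₁ :=
      Int.le_of_dvd (by omega) ((hχ_iff _ _).1 (hm₂.2.trans hm₁.2.symm))
    rw [pow_succ] at hfar
    refine ⟨m₁ + 2 ^ k, m₁, hm₁.1, m₂, hm₂.1, by omega, by omega,
      hdigit _ _ _ m₁ hm₁.1 hm₂.1 hm₁.1 hy ?_ ?_ ?_, fun j hj ↦ ?_⟩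
    · rw [hya, hm₁.2]; exact hab.le
    · rw [hya, hm₂.2]; exact hab.le
    · rw [hya, hm₁.2]; exact hab
    · rw [add_sub_cancel_left]
      exact pow_dvd_pow 2 (hle j hj)
  · -- at least three low points: two of them are on the same side of `b`
    have ha3 : 3 ≤ (S.filter fun m ↦ χ m = χ a).card := by omega
    obtain ⟨u, v, w, hu, hv, hw, huv, huw, hvw⟩ := Finset.two_lt_card_iff.1 ha3
    rw [Finset.mem_filter] at hu hv hw
    have hne : ∀ m, χ m = χ a → m ≠ b := fun m hm h ↦ hab.ne (by rw [← hm, h])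
    have hcase : ∃ y z, (y ∈ S ∧ χ y = χ a) ∧ (z ∈ S ∧ χ z = χ a) ∧
        ((b < y ∧ y < z) ∨ (z < y ∧ y < b)) := by
      have hpair : ∀ u v, u ∈ S ∧ χ u = χ a → v ∈ S ∧ χ v = χ a → u ≠ v →
          (b < u ∧ b < v) ∨ (u < b ∧ v < b) → ∃ y z, (y ∈ S ∧ χ y = χ a) ∧ (z ∈ S ∧ χ z = χ a) ∧
            ((b < y ∧ y < z) ∨ (z < y ∧ y < b)) := by
        rintro u v hu hv huv (h | h) <;> rcases lt_or_gt_of_ne huv with h' | h'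
        · exact ⟨u, v, hu, hv, Or.inl ⟨h.1, h'⟩⟩
        · exact ⟨v, u, hv, hu, Or.inl ⟨h.2, h'⟩⟩
        · exact ⟨v, u, hv, hu, Or.inr ⟨h', h.2⟩⟩
        · exact ⟨u, v, hu, hv, Or.inr ⟨h', h.1⟩⟩
      rcases lt_or_gt_of_ne (hne u hu.2) with h1 | h1 <;>
        rcases lt_or_gt_of_ne (hne v hv.2) with h2 | h2
      · exact hpair u v hu hv huv (Or.inr ⟨h1, h2⟩)
      · rcases lt_or_gt_of_ne (hne w hw.2) with h3 | h3
        · exact hpair u w hu hw huw (Or.inr ⟨h1, h3⟩)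
        · exact hpair v w hv hw hvw (Or.inl ⟨h2, h3⟩)
      · rcases lt_or_gt_of_ne (hne w hw.2) with h3 | h3
        · exact hpair v w hv hw hvw (Or.inr ⟨h2, h3⟩)
        · exact hpair u w hu hw huw (Or.inl ⟨h1, h3⟩)
      · exact hpair u v hu hv huv (Or.inl ⟨h1, h2⟩)
    obtain ⟨y, z, hy, hz, h | h⟩ := hcase
    · refine ⟨y, b, hb, z, hz.1, h.1, h.2, hdigit y b z b hb hz.1 hb (hk hy.1 ha) ?_ ?_ ?_,
        fun j hj ↦ hj y hy.1 b hb⟩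
      · rw [hy.2]; exact hab.le
      · rw [hy.2, hz.2]
      · rw [hy.2]; exact hab
    · refine ⟨y, z, hz.1, b, hb, h.1, h.2, hdigit y z b b hz.1 hb hb (hk hy.1 ha) ?_ ?_ ?_,
        fun j hj ↦ hj y hy.1 z hz.1⟩
      · rw [hy.2, hz.2]
      · rw [hy.2]; exact hab.le
      · rw [hy.2]; exact hab

theorem DigitAbove.mono_left {p K : ℕ} {s : ℝ} {C D C' : Finset (Fin d → ℤ)} {y : Fin d → ℤ}
    (h : DigitAbove p K s C C' y) (hC : C ⊆ D) : DigitAbove p K s D C' y := by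
  obtain ⟨k, hk, h1, a, ha, h2⟩ := h
  exact ⟨k, hk, h1, a, hC ha, h2⟩

/-- Of seven points, at least four share the first varying digit, and some point `q` has the other
value. The point `q` settles one side, and the one-sided statement applied inside the majority class
settles the other at a later digit. -/
theorem exists_between_digitAbove_both {x : ℤ → Fin d → ℤ} (hinj : Function.Injective x)
    (hx : ∀ k m m', LatticeCong (2 ^ k) (x m) (x m') ↔ (2 : ℤ) ^ k ∣ m - m') {K : ℕ}
    {S : Finset ℤ} (hS : 7 ≤ S.card)
    (hK : ∀ m ∈ S, ∀ m' ∈ S, LatticeCong (2 ^ K) (x m) (x m') → x m = x m') :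
    ∃ y, ∃ m₁ ∈ S, ∃ m₂ ∈ S, m₁ < y ∧ y < m₂ ∧
      DigitAbove 2 K 1 (S.image x) {x m₁, x m₂} (x y) ∧
      DigitAbove 2 K (-1) (S.image x) {x m₁, x m₂} (x y) := by
  obtain ⟨k, hkK, hk, hsplit⟩ := exists_first_split (p := 2) (K := K) (C := S.image x)
    (by rw [Finset.card_image_of_injective _ hinj]; omega) (by simpa using hK)
  simp only [Finset.forall_mem_image, Finset.exists_mem_image, hx] at hk hsplit
  obtain ⟨a, ha, b, hb, hab⟩ := hsplit
  -- the majority class, together with a point outside of it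
  have hmaj : ∃ c ∈ S, ∃ q ∈ S, ¬ (2 : ℤ) ^ (k + 1) ∣ c - q ∧
      4 ≤ (S.filter fun m ↦ (2 : ℤ) ^ (k + 1) ∣ m - c).card := by
    by_cases h4 : 4 ≤ (S.filter fun m ↦ (2 : ℤ) ^ (k + 1) ∣ m - a).card
    · exact ⟨a, ha, b, hb, hab, h4⟩
    · refine ⟨b, hb, a, ha, fun h ↦ hab (by rw [← neg_sub]; exact h.neg_right), ?_⟩
      have hsub : S ⊆ (S.filter fun m ↦ (2 : ℤ) ^ (k + 1) ∣ m - a) ∪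
          (S.filter fun m ↦ (2 : ℤ) ^ (k + 1) ∣ m - b) := fun m hm ↦ by
        simp only [Finset.mem_union, Finset.mem_filter]
        rcases two_pow_succ_dvd_or (hk ha hb) hab (hk hm ha) with h | h
        · exact Or.inl ⟨hm, h⟩
        · exact Or.inr ⟨hm, h⟩
      have := (Finset.card_le_card hsub).trans (Finset.card_union_le _ _)
      omega
  obtain ⟨c, hc, q, hq, hcq, h4⟩ := hmaj
  set D := S.filter fun m ↦ (2 : ℤ) ^ (k + 1) ∣ m - c with hD
  have hDS : D ⊆ S := Finset.filter_subset _ _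
  have key : ∀ s : ℝ, s ≠ 0 →
      s * residueCode (2 ^ (k + 1)) (x c) < s * residueCode (2 ^ (k + 1)) (x q) →
      ∃ y, ∃ m₁ ∈ S, ∃ m₂ ∈ S, m₁ < y ∧ y < m₂ ∧
        DigitAbove 2 K s (S.image x) {x m₁, x m₂} (x y) ∧
        DigitAbove 2 K (-s) (S.image x) {x m₁, x m₂} (x y) := by
    intro s hs hlt
    obtain ⟨y, m₁, hm₁, m₂, hm₂, h1, h2, hdig, hcls⟩ := exists_between_digitAbove hinj hx h4
      (fun m hm m' hm' ↦ hK m (hDS hm) m' (hDS hm')) (neg_ne_zero.2 hs)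
    have hDcls : ∀ m ∈ D, ∀ m' ∈ D, (2 : ℤ) ^ (k + 1) ∣ m - m' := fun m hm m' hm' ↦ by
      rw [show m - m' = (m - c) - (m' - c) by ring]
      exact ((Finset.mem_filter.1 hm).2).sub (Finset.mem_filter.1 hm').2
    have hyc : (2 : ℤ) ^ (k + 1) ∣ y - c := by
      rw [show y - c = (y - m₁) + (m₁ - c) by ring]
      exact (hcls _ hDcls).add (Finset.mem_filter.1 hm₁).2
    have hcode : ∀ m ∈ D, residueCode (2 ^ (k + 1)) (x m) = residueCode (2 ^ (k + 1)) (x y) :=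
      fun m hm ↦ by
        rw [residueCode_eq_iff, hx, show m - y = (m - c) - (y - c) by ring]
        exact ((Finset.mem_filter.1 hm).2).sub hyc
    have hcD : c ∈ D := Finset.mem_filter.2 ⟨hc, by simp⟩
    have hSy : ∀ m ∈ S, LatticeCong (2 ^ k) (x m) (x y) := fun m hm ↦ by
      rw [hx, show m - y = (m - c) - (y - c) by ring]
      exact (hk hm hc).sub ((pow_dvd_pow 2 (by omega)).trans hyc)
    refine ⟨y, m₁, hDS hm₁, m₂, hDS hm₂, h1, h2, ⟨k, hkK, fun c' hc' ↦ ?_, x q,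
      Finset.mem_image_of_mem x hq, hSy q hq, ?_⟩, hdig.mono_left (Finset.image_mono x hDS)⟩
    · rw [Finset.mem_insert, Finset.mem_singleton] at hc'
      rcases hc' with rfl | rfl
      · exact ⟨hSy _ (hDS hm₁), by rw [hcode _ hm₁]⟩
      · exact ⟨hSy _ (hDS hm₂), by rw [hcode _ hm₂]⟩
    · rw [← hcode c hcD]; exact hlt
  have hne : residueCode (2 ^ (k + 1)) (x c) ≠ residueCode (2 ^ (k + 1)) (x q) := by
    rw [Ne, residueCode_eq_iff, hx]; exact hcq
  rcases lt_or_gt_of_ne hne with h | h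
  · exact key 1 one_ne_zero (by linarith)
  · obtain ⟨y, m₁, hm₁, m₂, hm₂, h1, h2, h3, h4⟩ := key (-1) (by norm_num) (by linarith)
    exact ⟨y, m₁, hm₁, m₂, hm₂, h1, h2, by simpa using h4, h3⟩

theorem isCorePoint_line (b v : Fin d → ℤ) {m₁ y m₂ : ℤ} (h₁ : m₁ < y) (h₂ : y < m₂) :
    IsCorePoint (Submodule.span ℝ {latticePoint v}) (convexHull ℝ (latticePoint ''
      (({b + m₁ • v, b + m₂ • v} : Finset (Fin d → ℤ)) : Set (Fin d → ℤ))))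
      (latticePoint (b + y • v)) := by
  have h1 : (0 : ℝ) < y - m₁ := by rw [sub_pos]; exact_mod_cast h₁
  have h2 : (0 : ℝ) < m₂ - y := by rw [sub_pos]; exact_mod_cast h₂
  have h3 : (0 : ℝ) < m₂ - m₁ := by linarith
  have key := isCorePoint_add_sum (ι := Unit) (convex_convexHull ℝ (latticePoint ''
      (({b + m₁ • v, b + m₂ • v} : Finset (Fin d → ℤ)) : Set (Fin d → ℤ))))
    (a := latticePoint (b + m₁ • v)) (g := fun _ ↦ latticePoint (b + m₂ • v))
    (θ := fun _ ↦ ((y - m₁) / (m₂ - m₁) : ℝ))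
    (subset_convexHull ℝ _ (Set.mem_image_of_mem _ (by simp)))
    (fun _ ↦ subset_convexHull ℝ _ (Set.mem_image_of_mem _ (by simp)))
    (fun _ ↦ div_pos h1 h3) (by
      rw [Fintype.sum_unique, div_lt_one h3]; linarith)
  have e1 : latticePoint (b + m₂ • v) - latticePoint (b + m₁ • v) =
      ((m₂ : ℝ) - m₁) • latticePoint v := by
    simp only [latticePoint_add, latticePoint_zsmul]; module
  have e2 : latticePoint (b + m₁ • v) + ∑ _j : Unit, ((y - m₁) / (m₂ - m₁) : ℝ) •
      (latticePoint (b + m₂ • v) - latticePoint (b + m₁ • v)) = latticePoint (b + y • v) := by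
    rw [Fintype.sum_unique, e1, smul_smul, div_mul_cancel₀ _ h3.ne']
    simp only [latticePoint_add, latticePoint_zsmul]; module
  rw [e2] at key
  refine key.mono ?_ subset_rfl
  rw [Submodule.span_singleton_le_iff_mem, Set.range_const, e1]
  exact Submodule.mem_span_singleton.2 ⟨((m₂ : ℝ) - m₁)⁻¹, by
    rw [smul_smul, inv_mul_cancel₀ h3.ne', one_smul]⟩

end Line

/-! ### The planar theorem with seven points. -/

section Plane

/-- A direction that is not parallel to any vector between two points of `[1, n]^2`. -/
noncomputable def transversal (n : ℕ) : EuclideanSpace ℝ (Fin 2) := WithLp.toLp 2 ![1, (n : ℝ) + 1]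

theorem exists_coordinates_transversal {n : ℕ} {v : Fin 2 → ℤ} (hv : v 0 * (n + 1) - v 1 ≠ 0)
    (z : EuclideanSpace ℝ (Fin 2)) :
    z = (((n + 1) * z 0 - z 1) / (v 0 * (n + 1) - v 1) : ℝ) • latticePoint v +
      ((v 0 * z 1 - v 1 * z 0) / (v 0 * (n + 1) - v 1) : ℝ) • transversal n := by
  have hv' : (v 0 * (n + 1) - v 1 : ℝ) ≠ 0 := by exact_mod_cast hv
  obtain ⟨Δ, hΔ⟩ : ∃ Δ : ℝ, Δ = v 0 * (n + 1) - v 1 := ⟨_, rfl⟩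
  rw [← hΔ] at hv' ⊢
  ext i
  fin_cases i
  · simp [transversal]
    field_simp
    rw [hΔ]
    ring
  · simp [transversal]
    field_simp
    rw [hΔ]
    ring

theorem span_sup_span_transversal {n : ℕ} {v : Fin 2 → ℤ} (hv : v 0 * (n + 1) - v 1 ≠ 0) :
    Submodule.span ℝ {latticePoint v} ⊔ Submodule.span ℝ {transversal n} = ⊤ := by
  rw [eq_top_iff]
  intro z _
  rw [exists_coordinates_transversal hv z]
  exact Submodule.add_mem_sup (Submodule.smul_mem _ _ (Submodule.mem_span_singleton_self _))
    (Submodule.smul_mem _ _ (Submodule.mem_span_singleton_self _))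

theorem latticeCong_line_iff {b v : Fin 2 → ℤ} (hv : IsCoprime (v 0) (v 1)) (k : ℕ) (m m' : ℤ) :
    LatticeCong (2 ^ k) (b + m • v) (b + m' • v) ↔ (2 : ℤ) ^ k ∣ m - m' := by
  have hsub : ∀ i, (b + m • v) i - (b + m' • v) i = (m - m') * v i := fun i ↦ by simp; ring
  constructor
  · intro h
    obtain ⟨p, q, hpq⟩ := hv
    have h0 := h 0
    have h1 := h 1
    rw [hsub] at h0 h1
    have : m - m' = p * ((m - m') * v 0) + q * ((m - m') * v 1) := by
      linear_combination (-(m - m')) * hpq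
    rw [this]
    exact_mod_cast (h0.mul_left p).add (h1.mul_left q)
  · intro h i
    rw [hsub]
    exact_mod_cast h.mul_right (v i)

theorem line_injective {b v : Fin 2 → ℤ} (hv : IsCoprime (v 0) (v 1)) :
    Function.Injective fun m : ℤ ↦ b + m • v := by
  intro m m' h
  obtain ⟨p, q, hpq⟩ := hv
  have h0 := congrFun h 0
  have h1 := congrFun h 1
  simp at h0 h1
  have e0 : (m - m') * v 0 = 0 := by rcases h0 with h | h <;> simp [h]
  have e1 : (m - m') * v 1 = 0 := by rcases h1 with h | h <;> simp [h]
  have : m - m' = 0 := by linear_combination p * e0 + q * e1 - (m - m') * hpq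
  omega

/-- Two distinct box points on the line force `|v i| < n + 1`, while being parallel to `transversal
n` means `v 1 = (n + 1) * v 0`; together these give `v = 0`. -/
theorem det_transversal_ne_zero {n : ℕ} {b v : Fin 2 → ℤ} (hv : IsCoprime (v 0) (v 1)) {m m' : ℤ}
    (hm : m ≠ m') (h : b + m • v ∈ latticeBox 2 n) (h' : b + m' • v ∈ latticeBox 2 n) :
    v 0 * (n + 1) - v 1 ≠ 0 := by
  have hbound : ∀ i, |v i| < n + 1 := fun i ↦ by
    have h1 := mem_latticeBox.1 h i
    have h2 := mem_latticeBox.1 h' i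
    simp at h1 h2
    have h3 : |(m - m') * v i| < n + 1 := by
      rw [sub_mul, abs_lt]; constructor <;> linarith
    have h4 : 1 ≤ |m - m'| := Int.one_le_abs (sub_ne_zero.2 hm)
    rw [abs_mul] at h3
    exact lt_of_le_of_lt (le_mul_of_one_le_left (abs_nonneg _) h4) h3
  intro h0
  have h1 : v 1 = 0 := Int.eq_zero_of_abs_lt_dvd (m := (n : ℤ) + 1) ⟨v 0, by linarith⟩ (hbound 1)
  rw [h1, sub_zero] at h0
  have h2 : v 0 = 0 := by
    rcases mul_eq_zero.1 h0 with h | h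
    · exact h
    · omega
  obtain ⟨p, q, hpq⟩ := hv
  rw [h1, h2, mul_zero, mul_zero, add_zero] at hpq
  exact zero_ne_one hpq

theorem eventually_exists_mem_interior {n : ℕ} {A C' : Finset (Fin 2 → ℤ)}
    (hA : A ⊆ latticeBox 2 n) (hC' : C' ⊆ A) {F : Submodule ℝ (EuclideanSpace ℝ (Fin 2))}
    (hF : F ⊔ Submodule.span ℝ {transversal n} = ⊤) {y : Fin 2 → ℤ}
    (hcore : IsCorePoint F (convexHull ℝ (latticePoint '' (C' : Set (Fin 2 → ℤ)))) (latticePoint y))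
    (hup : EventuallyBeyond 2 n 1 latticePoint (transversal n) A y)
    (hlow : EventuallyBeyond 2 n (-1) latticePoint (transversal n) A y) :
    ∀ᶠ r : ℝ in 𝓝[>] 0, ∃ y ∈ latticeBox 2 n,
      latticePoint y + towerHeight 2 n r y • transversal n ∈ interior (convexHull ℝ
        ((fun x ↦ latticePoint x + towerHeight 2 n r x • transversal n) ''
          (A : Set (Fin 2 → ℤ)))) := by
  filter_upwards [hcore.eventually_perturb_of_beyond hC' hup hlow] with r hr
  rw [hF] at hr
  exact ⟨y, mem_latticeBox_of_mem_convexHull (hC'.trans hA) hcore.mem,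
    hr.mem_interior (convex_convexHull ℝ _)⟩

theorem mem_interior_of_forall_coeff {A : Finset (Fin 2 → ℤ)} (hA : A.Nonempty) {z : Fin 2 → ℤ}
    (hz : ∀ α β : ℝ, (∀ a ∈ A, α * a 0 + β * a 1 ≤ α * z 0 + β * z 1) → α = 0 ∧ β = 0) :
    latticePoint z ∈ interior (convexHull ℝ (latticePoint '' (A : Set (Fin 2 → ℤ)))) := by
  refine mem_interior_convexHull_of_forall_functional (by simpa using hA) fun f hf ↦ ?_
  have hdecomp : ∀ x : EuclideanSpace ℝ (Fin 2), x =
      x 0 • EuclideanSpace.single 0 (1 : ℝ) + x 1 • EuclideanSpace.single 1 (1 : ℝ) := fun x ↦ by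
    ext i; fin_cases i <;> simp
  have hval : ∀ x : EuclideanSpace ℝ (Fin 2), f x = f (EuclideanSpace.single 0 1) * x 0 +
      f (EuclideanSpace.single 1 1) * x 1 := fun x ↦ by
    conv_lhs => rw [hdecomp x]
    rw [map_add, map_smul, map_smul, smul_eq_mul, smul_eq_mul]
    ring
  obtain ⟨h0, h1⟩ := hz (f (EuclideanSpace.single 0 1)) (f (EuclideanSpace.single 1 1))
    fun a ha ↦ by
      have := hf _ (Set.mem_image_of_mem _ ha)
      rw [hval (latticePoint a), hval (latticePoint z)] at this
      simpa using this
  ext x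
  rw [hval, h0, h1]
  simp

theorem eventually_exists_mem_interior_of_card {n : ℕ} {A : Finset (Fin 2 → ℤ)}
    (hA : A ⊆ latticeBox 2 n) (hcard : A.card = 7) :
    ∀ᶠ r : ℝ in 𝓝[>] 0, ∃ y ∈ latticeBox 2 n,
      latticePoint y + towerHeight 2 n r y • transversal n ∈ interior (convexHull ℝ
        ((fun x ↦ latticePoint x + towerHeight 2 n r x • transversal n) ''
          (A : Set (Fin 2 → ℤ)))) := by
  rcases exists_interior_or_four_on_line hcard with ⟨z, hz⟩ | ⟨v, hv, t, ht⟩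
  · -- an interior lattice point stays interior
    have hcore : IsCorePoint ⊤ (convexHull ℝ (latticePoint '' (A : Set (Fin 2 → ℤ))))
        (latticePoint z) := isCorePoint_of_mem_interior
      (mem_interior_of_forall_coeff (Finset.card_pos.1 (by omega)) hz)
    obtain ⟨τ, hτ, h1⟩ := hcore (transversal n) trivial
    obtain ⟨τ', hτ', h2⟩ := hcore (-transversal n) trivial
    refine eventually_exists_mem_interior hA subset_rfl (top_sup_eq _) hcore
      (eventuallyBeyond_of_mem (c := τ) (by linarith) h1)
      (eventuallyBeyond_of_mem (c := -τ') (by linarith) (by simpa using h2))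
  · obtain ⟨b, hb⟩ : (A.filter fun x ↦ v 0 * x 1 - v 1 * x 0 = t).Nonempty :=
      Finset.card_pos.1 (by omega)
    rw [Finset.mem_filter] at hb
    obtain ⟨p, q, hpq⟩ := id hv
    -- parametrize the line by the integers
    set x : ℤ → Fin 2 → ℤ := fun m ↦ b + m • v with hx
    have hinj : Function.Injective x := line_injective hv
    have hcong := latticeCong_line_iff (b := b) hv
    have hparam : ∀ a : Fin 2 → ℤ, v 0 * a 1 - v 1 * a 0 = t →
        x (p * (a 0 - b 0) + q * (a 1 - b 1)) = a := fun a ha ↦ by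
      have h := hb.2
      funext i
      fin_cases i
      · simp [hx]; linear_combination (a 0 - b 0) * hpq + q * (ha - h)
      · simp [hx]; linear_combination (a 1 - b 1) * hpq - p * (ha - h)
    have honline : ∀ m, v 0 * x m 1 - v 1 * x m 0 = t := fun m ↦ by
      simp [hx]; linear_combination hb.2
    set S : Finset ℤ := (A.filter fun x ↦ v 0 * x 1 - v 1 * x 0 = t).image
      fun a ↦ p * (a 0 - b 0) + q * (a 1 - b 1) with hS
    have hSx : S.image x = A.filter fun x ↦ v 0 * x 1 - v 1 * x 0 = t := by
      rw [hS, Finset.image_image]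
      conv_rhs => rw [← Finset.image_id (s := A.filter fun x ↦ v 0 * x 1 - v 1 * x 0 = t)]
      exact Finset.image_congr fun a ha ↦ hparam a (Finset.mem_filter.1 ha).2
    have hSA : S.image x ⊆ A := hSx ▸ Finset.filter_subset _ _
    have hScard : S.card = (A.filter fun x ↦ v 0 * x 1 - v 1 * x 0 = t).card := by
      rw [← hSx, Finset.card_image_of_injective _ hinj]
    have hbox : ∀ m ∈ S, x m ∈ latticeBox 2 n := fun m hm ↦ hA (hSA (Finset.mem_image_of_mem x hm))
    have hK : ∀ m ∈ S, ∀ m' ∈ S, LatticeCong (2 ^ n) (x m) (x m') → x m = x m' :=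
      fun m hm m' hm' ↦ eq_of_latticeCong_pow (by norm_num) (hbox m hm) (hbox m' hm')
    have hdet : v 0 * (n + 1) - v 1 ≠ 0 := by
      obtain ⟨m, hm, m', hm', hne⟩ := Finset.one_lt_card.1 (show 1 < S.card by omega)
      exact det_transversal_ne_zero hv hne (hbox m hm) (hbox m' hm')
    have hF : ∀ y, ∀ a ∈ S.image x, latticePoint a - latticePoint (x y) ∈
        Submodule.span ℝ {latticePoint v} := by
      intro y a ha
      obtain ⟨m, -, rfl⟩ := Finset.mem_image.1 ha
      refine Submodule.mem_span_singleton.2 ⟨(m : ℝ) - y, ?_⟩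
      simp only [hx, latticePoint_add, latticePoint_zsmul]
      module
    have hpair : ∀ m₁ ∈ S, ∀ m₂ ∈ S, ({x m₁, x m₂} : Finset (Fin 2 → ℤ)) ⊆ S.image x := by
      intro m₁ hm₁ m₂ hm₂ a ha
      rw [Finset.mem_insert, Finset.mem_singleton] at ha
      rcases ha with rfl | rfl
      · exact Finset.mem_image_of_mem x hm₁
      · exact Finset.mem_image_of_mem x hm₂
    by_cases hall : ∀ a ∈ A, v 0 * a 1 - v 1 * a 0 = t
    · rw [Finset.filter_true_of_mem hall, hcard] at hScard
      obtain ⟨y, m₁, hm₁, m₂, hm₂, h1, h2, hup, hlow⟩ :=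
        exists_between_digitAbove_both hinj hcong hScard.ge hK
      have hcore := isCorePoint_line b v h1 h2
      exact eventually_exists_mem_interior hA ((hpair m₁ hm₁ m₂ hm₂).trans hSA)
        (span_sup_span_transversal hdet) hcore
        ((hup.eventuallyBeyond (hpair m₁ hm₁ m₂ hm₂) hcore (hF y)).mono hSA)
        ((hlow.eventuallyBeyond (hpair m₁ hm₁ m₂ hm₂) hcore (hF y)).mono hSA)
    · push Not at hall
      obtain ⟨a, haA, hat⟩ := hall
      set Δ : ℝ := v 0 * (n + 1) - v 1 with hΔ
      have hΔ0 : Δ ≠ 0 := by rw [hΔ]; exact_mod_cast hdet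
      -- the side of the line on which `a` lies
      set c : ℝ := (v 0 * a 1 - v 1 * a 0 - t) / Δ with hc
      have hc0 : c ≠ 0 := by
        refine div_ne_zero ?_ hΔ0
        have : v 0 * a 1 - v 1 * a 0 - t ≠ 0 := sub_ne_zero.2 hat
        exact_mod_cast this
      -- The point `a` will serve the side of sign `c`, so the line has to serve the side `-c`.
      obtain ⟨y, m₁, hm₁, m₂, hm₂, h1, h2, hdig, -⟩ :=
        exists_between_digitAbove hinj hcong (hScard ▸ ht) hK (s := -c) (neg_ne_zero.2 hc0)
      have hcore := isCorePoint_line b v h1 h2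
      have hline := (hdig.eventuallyBeyond (hpair m₁ hm₁ m₂ hm₂) hcore (hF y)).mono hSA
        (e := transversal n)
      -- Moving along the line against the `v`-component of `a - x y` and then mixing with `a`
      -- cancels that component; what remains is a fixed displacement along `transversal n` of sign
      -- `c`.
      have hoff : EventuallyBeyond 2 n c latticePoint (transversal n) A (x y) := by
        have hdec := exists_coordinates_transversal hdet (latticePoint a - latticePoint (x y))
        set γ : ℝ := ((n + 1) * (latticePoint a - latticePoint (x y)) 0 -
          (latticePoint a - latticePoint (x y)) 1) / (v 0 * (n + 1) - v 1)
        have hcc : (v 0 * (latticePoint a - latticePoint (x y)) 1 -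
            v 1 * (latticePoint a - latticePoint (x y)) 0) / (v 0 * (n + 1) - v 1) = c := by
          rw [hc, hΔ]
          congr 1
          have : (v 0 * x y 1 - v 1 * x y 0 : ℝ) = t := by exact_mod_cast honline y
          simp only [PiLp.sub_apply, latticePoint_apply]
          linear_combination -this
        rw [hcc] at hdec
        obtain ⟨τ, hτ, hmem⟩ := hcore (-(γ • latticePoint v)) (Submodule.neg_mem _
          (Submodule.smul_mem _ _ (Submodule.mem_span_singleton_self _)))
        have hmem' := convexHull_mono (Set.image_mono (f := latticePoint)
          (show ((({b + m₁ • v, b + m₂ • v} : Finset (Fin 2 → ℤ)) : Set (Fin 2 → ℤ))) ⊆ A from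
            Finset.coe_subset.2 ((hpair m₁ hm₁ m₂ hm₂).trans hSA))) hmem
        have hconv := convex_convexHull ℝ (latticePoint '' (A : Set (Fin 2 → ℤ))) hmem'
          (subset_convexHull ℝ _ (Set.mem_image_of_mem latticePoint haA))
          (a := 1 / (1 + τ)) (b := τ / (1 + τ)) (by positivity) (by positivity)
          (by field_simp)
        refine eventuallyBeyond_of_mem (c := τ / (1 + τ) * c) ?_ ?_
        · have : 0 < c * c := mul_self_pos.2 hc0
          have : 0 < τ / (1 + τ) := by positivity
          nlinarith
        · convert hconv using 1
          have ha : latticePoint a = latticePoint (x y) + (γ • latticePoint v +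
              c • transversal n) := by rw [← hdec]; abel
          rw [ha]
          change latticePoint (x y) + _ = (1 / (1 + τ)) • (latticePoint (x y) + _) + _
          have hone : (1 / (1 + τ) + τ / (1 + τ) : ℝ) = 1 := by field_simp
          have htau : (1 / (1 + τ) * τ : ℝ) = τ / (1 + τ) := by ring
          calc latticePoint (x y) + (τ / (1 + τ) * c) • transversal n
              = (1 / (1 + τ) + τ / (1 + τ) : ℝ) • latticePoint (x y)
                + (τ / (1 + τ) - 1 / (1 + τ) * τ) • γ • latticePoint v
                + (τ / (1 + τ) * c) • transversal n := by
                rw [hone, htau, sub_self, zero_smul, add_zero, one_smul]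
            _ = _ := by module
      have hscale : ∀ {σ s : ℝ}, 0 < σ * s →
          EventuallyBeyond 2 n s latticePoint (transversal n) A (x y) →
          EventuallyBeyond 2 n σ latticePoint (transversal n) A (x y) := by
        intro σ s hσ h
        filter_upwards [h] with r ⟨u, hu, hmem⟩
        refine ⟨u, ?_, hmem⟩
        have h1 : 0 < s * (u - towerHeight 2 n r (x y)) := by linarith
        have h2 : 0 < σ * (u - towerHeight 2 n r (x y)) := by
          have hs2 : 0 < s * s := mul_self_pos.2 (by rintro rfl; simp at hσ)
          have : 0 < (σ * s) * (s * (u - towerHeight 2 n r (x y))) := mul_pos hσ h1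
          have : 0 < (s * s) * (σ * (u - towerHeight 2 n r (x y))) := by linarith
          exact (pos_iff_pos_of_mul_pos this).1 hs2
        linarith
      rcases lt_or_gt_of_ne hc0 with h | h
      · exact eventually_exists_mem_interior hA ((hpair m₁ hm₁ m₂ hm₂).trans hSA)
          (span_sup_span_transversal hdet) hcore (hscale (by linarith) hline)
          (hscale (by linarith) hoff)
      · exact eventually_exists_mem_interior hA ((hpair m₁ hm₁ m₂ hm₂).trans hSA)
          (span_sup_span_transversal hdet) hcore (hscale (by linarith) hoff)
          (hscale (by linarith) hline)

theorem exists_interior_perturbation_plane (n : ℕ) {ε : ℝ} (hε : 0 < ε) :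
    ∃ Q : (Fin 2 → ℤ) → EuclideanSpace ℝ (Fin 2),
      (∀ x ∈ latticeBox 2 n, ‖Q x - latticePoint x‖ < ε) ∧
      ∀ A ⊆ latticeBox 2 n, A.card = 7 → ∃ y ∈ latticeBox 2 n,
        Q y ∈ interior (convexHull ℝ (Q '' (A : Set (Fin 2 → ℤ)))) := by
  have h1 : ∀ᶠ r : ℝ in 𝓝[>] 0, ∀ x ∈ latticeBox 2 n,
      ‖latticePoint x + towerHeight 2 n r x • transversal n - latticePoint x‖ < ε := by
    rw [eventually_all_finset]
    intro x _
    have := ((tendsto_towerHeight 2 n x).smul_const (transversal n)).norm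
    rw [zero_smul, norm_zero] at this
    filter_upwards [this.eventually (gt_mem_nhds hε)] with r hr
    rwa [add_sub_cancel_left]
  have h2 : ∀ᶠ r : ℝ in 𝓝[>] 0, ∀ A ∈ (latticeBox 2 n).powersetCard 7, ∃ y ∈ latticeBox 2 n,
      latticePoint y + towerHeight 2 n r y • transversal n ∈ interior (convexHull ℝ
        ((fun x ↦ latticePoint x + towerHeight 2 n r x • transversal n) ''
          (A : Set (Fin 2 → ℤ)))) := by
    rw [eventually_all_finset]
    intro A hA
    rw [Finset.mem_powersetCard] at hA
    exact eventually_exists_mem_interior_of_card hA.1 hA.2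
  obtain ⟨r, h1, h2⟩ := (h1.and h2).exists
  exact ⟨fun x ↦ latticePoint x + towerHeight 2 n r x • transversal n, h1,
    fun A hA hcard ↦ h2 A (Finset.mem_powersetCard.2 ⟨hA, hcard⟩)⟩

end Plane

theorem theorem2 :
    ∃ C : ℕ → ℕ,
      (∃ K : ℕ, ∀ d : ℕ, 2 ≤ d → C d ≤ d ^ (K * d ^ 3)) ∧
      C 2 = 7 ∧
      ∀ d : ℕ, 2 ≤ d → ∀ n : ℕ, 1 ≤ n → ∀ ε : ℝ, 0 < ε →
        ∃ (P : EuclideanSpace ℝ (Fin d) → EuclideanSpace ℝ (Fin d))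
          (B : Set (EuclideanSpace ℝ (Fin d))),
          IsPerturbation ε P (latticeCube d n) B ∧ IsHoleFree (C d) B := by
  refine ⟨fun d ↦ if d = 2 then 7 else
    2 * (∏ j ∈ Finset.range d, Nat.nth Nat.Prime j ^ (2 * d)) ^ (d + 1) *
      (d * ∏ j ∈ Finset.range d, Nat.nth Nat.Prime j + 1) ^ d, ⟨40, fun d hd ↦ ?_⟩, if_pos rfl,
    fun d hd n _ ε hε ↦ exists_isPerturbation_isHoleFree hε fun δ hδ ↦ ?_⟩
  · dsimp only
    split_ifs with h
    · subst h
      calc 7 ≤ 2 ^ 3 := by norm_num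
        _ ≤ 2 ^ (40 * 2 ^ 3) := Nat.pow_le_pow_right (by norm_num) (by norm_num)
    · exact holeFree_bound hd fun j hj ↦ nth_prime_le_pow hd hj
  · dsimp only
    split_ifs with h
    · subst h
      exact exists_interior_perturbation_plane n hδ
    · exact exists_interior_perturbation n (fun i ↦ Nat.prime_nth_prime i)
        (Nat.nth_injective Nat.infinite_setOfPred_prime) hδ le_rfl
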